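/- Let $M$ be a (finite-dimensional, Hausdorff, second countable) complex manifold, let $\pi:V\to M$ be a holomorphic vector bundle of finite rank, and let $Q\subset M$ be a $k$-dimensional (embedded) real-analytic submanifold that is totally real, i.e. $T_pQ\cap i\,T_pQ=\{0\}$ for all $p\in Q$. A complexification of $Q$ in $M$ is a $k$-dimensional (embedded) complex submanifold $N\subset M$ that contains $Q$ as a generic totally real submanifold, i.e. $Q\subset N$ and $T_pQ\cap i\,T_pQ=\{0\}$, $T_pQ+i\,T_pQ=T_pN$ for all $p\in Q$. Let $X\in\Gamma(V|_Q)$ be a real-analytic section of $V$ over $Q$. Then there exists a complexification $\mathbb{C}Q\subset M$ of $Q$ over which $X$ has a unique holomorphic extension, i.e. there is exactly one holomorphic section $\mathbb{C}X\in\Gamma^{\mathrm{hol}}(V|_{\mathbb{C}Q})$ with $\mathbb{C}X|_Q=X$. Moreover, the pair $(\mathbb{C}Q,\mathbb{C}X)$ is locally unique near $Q$: if $N'\subset M$ is any complexification of $Q$ and $Y'$ is a holomorphic section of $V$ over $N'$ with $Y'|_Q=X$, then there is an open set $U\subset M$ containing $Q$ such that $\mathbb{C}Q\cap U=N'\cap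 U$ and $\mathbb{C}X=Y'$ on $\mathbb{C}Q\cap U$. -/

import Mathlib

open Set Topology Bundle
open scoped Manifold ContDiff Pointwise

noncomputable section

section Submanifolds

variable (𝕜 : Type*) [NontriviallyNormedField 𝕜]
  {E : Type*} [NormedAddCommGroup E] [NormedSpace 𝕜 E]
  {M : Type*} [TopologicalSpace M] [ChartedSpace E M]

/-- A `𝕜`-analytic chart `e` of `M` is a slice chart of `S` with slice `L`, a linear subspace of the
model space, if it straightens `S` to `L`, that is, `e (S ∩ e.source) = L ∩ e.target`. -/
def IsSliceChart (S : Set M) (e : OpenPartialHomeomorph M E) (L : Submodule 𝕜 E) : Prop :=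
  e ∈ IsManifold.maximalAtlas 𝓘(𝕜, E) ω M ∧ e.source ∩ S = e.source ∩ e ⁻¹' (L : Set E)

/-- `S` is an (embedded, not necessarily closed) `𝕜`-analytic submanifold of `M` of dimension `k`
over `𝕜`. For `𝕜 = ℝ` this is a real-analytic submanifold, for `𝕜 = ℂ` a complex submanifold. -/
def IsSubmanifold (k : ℕ) (S : Set M) : Prop :=
  ∀ p ∈ S, ∃ (e : OpenPartialHomeomorph M E) (L : Submodule 𝕜 E),
    p ∈ e.source ∧ Module.finrank 𝕜 L = k ∧ IsSliceChart 𝕜 S e L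

end Submanifolds

section TotallyReal

variable {E : Type*} [NormedAddCommGroup E] [NormedSpace ℂ E]
  {M : Type*} [TopologicalSpace M] [ChartedSpace E M]

/-- The tangent space of the submanifold `S` at `p`, as a subset of the (complex) tangent space of
`M` at `p`: the velocities at `p` of curves in `S`. As for Mathlib's `TangentSpace`, tangent vectors
at `p` are expressed in the preferred chart `chartAt E p`. -/
def tangentVectors (S : Set M) (p : M) : Set (TangentSpace 𝓘(ℂ, E) p) :=
  {v | ∃ γ : ℝ → M, γ 0 = p ∧ ContinuousAt γ 0 ∧ (∀ᶠ t in 𝓝 0, γ t ∈ S) ∧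
    HasDerivAt (fun t ↦ (chartAt E p (γ t) : E)) (v : E) 0}

variable (E) in
/-- `TS ∩ i TS = 0` at all points of `S`. -/
def IsTotallyReal (S : Set M) : Prop :=
  ∀ p ∈ S, tangentVectors (E := E) S p ∩ Complex.I • tangentVectors (E := E) S p = {0}

variable (E) in
/-- `TS + i TS = TN` at all points of `S`. -/
def IsGenericIn (S N : Set M) : Prop :=
  ∀ p ∈ S, tangentVectors (E := E) S p + Complex.I • tangentVectors (E := E) S p =
    tangentVectors (E := E) N p

variable (E) in
/-- `N` is a complexification in `M` of the `k`-dimensional set `Q ⊆ M`: a complex submanifold of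
`M` that contains `Q` as a real-analytic, generic, totally real submanifold. -/
structure IsComplexification (k : ℕ) (Q N : Set M) : Prop where
  isComplexSubmanifold : IsSubmanifold ℂ (E := E) k N
  isRealSubmanifold : IsSubmanifold ℝ (E := E) k Q
  subset : Q ⊆ N
  isTotallyReal : IsTotallyReal E Q
  isGenericIn : IsGenericIn E Q N

end TotallyReal

section Sections

open Classical in
/-- Extension by zero of a section over `S`. -/
def extendByZero {M : Type*} {V : M → Type*} [∀ x, Zero (V x)] {S : Set M}
    (X : (x : S) → V x) (x : M) : V x :=
  if h : x ∈ S then X ⟨x, h⟩ else 0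

variable (𝕜 : Type*) [NontriviallyNormedField 𝕜]
  {E : Type*} [NormedAddCommGroup E] [NormedSpace 𝕜 E]
  {M : Type*} [TopologicalSpace M] [ChartedSpace E M]
  (F : Type*) [NormedAddCommGroup F] [NormedSpace 𝕜 F]
  {V : M → Type*} [TopologicalSpace (TotalSpace F V)] [∀ x, Zero (V x)]
  [∀ x, TopologicalSpace (V x)] [FiberBundle F V]

/-- The section `X` over the submanifold `S` is a `𝕜`-analytic map from `S` to the total space of
the bundle: around each point it is analytic in the coordinates `u ∈ L ∩ e.target` on `S` given by a
slice chart. The points `e.symm u` lie in `S`, so the extension by zero only serves to make the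
expression total. For `𝕜 = ℝ` this is a real-analytic, for `𝕜 = ℂ` a holomorphic section. -/
def IsAnalyticSection {S : Set M} (X : (x : S) → V x) : Prop :=
  ∀ p ∈ S, ∃ (e : OpenPartialHomeomorph M E) (L : Submodule 𝕜 E),
    p ∈ e.source ∧ IsSliceChart 𝕜 S e L ∧
    ContMDiffOn 𝓘(𝕜, L) (𝓘(𝕜, E).prod 𝓘(𝕜, F)) ω
      (fun u : L ↦ TotalSpace.mk' F (e.symm (u : E)) (extendByZero X (e.symm (u : E))))
      {u : L | (u : E) ∈ e.target}

end Sections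

/-- The section `Y` over `N` extends the section `X` over `Q`. -/
def IsExtensionOf {M : Type*} {V : M → Type*} {Q N : Set M}
    (Y : (x : N) → V x) (X : (x : Q) → V x) : Prop :=
  Q ⊆ N ∧ ∀ (x : M) (hQ : x ∈ Q) (hN : x ∈ N), Y ⟨x, hN⟩ = X ⟨x, hQ⟩

end

/-!
A real-analytic germ on `ℝ^k` with values in a complex Banach space extends to a holomorphic germ on
`ℂ^k` with the same power series coefficients (`AnalyticAt.exists_complexification`), and the
extension is unique (`AnalyticAt.eventually_eq_zero_of_ofRealPi`). Everything local follows from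
these two facts.

*Local existence.* Near `q ∈ Q`, a real slice chart parametrizes `Q` by `ℝ^k`. Complexifying this
parametrization gives a holomorphic germ `Φ` on `ℂ^k`, which is an immersion exactly because `Q` is
totally real at `q` (`exists_isComplexParametrization`). The image of `Φ` is the local
complexification, and the complexified coordinates of `X` give the local extension
(`exists_local_extension`).

*Local uniqueness.* If `N` is any `k`-dimensional complex submanifold containing `Q` near `q`, then
the components of `Φ` transverse to `N` vanish on `ℝ^k`, hence identically, so `Φ` maps into `N`;
by equality of dimensions it parametrizes `N` near `q`
(`IsComplexParametrization.map_nhds_eq`). Two complexifications therefore have the same germ at `q`,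
and two holomorphic extensions of `X`, pulled back by `Φ`, agree on `ℝ^k` and so coincide
(`IsComplexParametrization.germ_unique`).

*Globalization.* By local uniqueness, the local complexifications and extensions define a section over
`Q` of a sheaf of germs on `M`. As `M` is metrizable, this section extends to a neighbourhood of `Q`
(`exists_glue_germs`, `exists_glued_extension`). Shrinking the result to a union of balls in slice
charts centred at points of `Q`, the identity theorem on each ball makes the extension unique
(`IsComplexification.extension_unique`). Genericity of `Q` is a dimension count
(`IsTotallyReal.isGenericIn`).
-/

/-! ### Complexification of real-analytic germs -/

section ComplexifyGerm

variable {ι : Type*}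

variable (ι) in
/-- The inclusion of `ℝ^ι` in `ℂ^ι`. -/
noncomputable def ofRealPi : (ι → ℝ) →L[ℝ] (ι → ℂ) :=
  ContinuousLinearMap.pi fun i ↦ Complex.ofRealCLM.comp (ContinuousLinearMap.proj i)

@[simp] theorem ofRealPi_apply (r : ι → ℝ) (i : ι) : ofRealPi ι r i = (r i : ℂ) := rfl

theorem exists_eq_ofRealPi_add (z : ι → ℂ) :
    ∃ x y : ι → ℝ, z = ofRealPi ι x + Complex.I • ofRealPi ι y := by
  refine ⟨fun i ↦ (z i).re, fun i ↦ (z i).im, funext fun i ↦ ?_⟩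
  simp [mul_comm Complex.I, Complex.re_add_im]

variable [Fintype ι] {E : Type*} [NormedAddCommGroup E] [NormedSpace ℂ E]

/-- Identity theorem: a holomorphic germ on `ℂ^ι` is determined by its restriction to `ℝ^ι`. -/
theorem AnalyticAt.eventually_eq_zero_of_ofRealPi [CompleteSpace E] {f : (ι → ℂ) → E}
    (hf : AnalyticAt ℂ f 0) (h : ∀ᶠ r in 𝓝 0, f (ofRealPi ι r) = 0) :
    ∀ᶠ z in 𝓝 0, f z = 0 := by
  obtain ⟨δ, hδ, hfδ⟩ := Metric.eventually_nhds_iff_ball.1 hf.eventually_analyticAt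
  obtain ⟨ε, hε, hfε⟩ := Metric.eventually_nhds_iff_ball.1 h
  set ρ := min δ ε with hρdef
  have hρ : 0 < ρ := lt_min hδ hε
  refine Metric.eventually_nhds_iff_ball.2 ⟨ρ / 3, by positivity, fun z hz ↦ ?_⟩
  -- On the complex line `t ↦ x + t y` through `z = x + i y`, `f` vanishes for real `t`.
  let x : ι → ℝ := fun i ↦ (z i).re
  let y : ι → ℝ := fun i ↦ (z i).im
  rw [mem_ball_zero_iff] at hz
  have hx : ‖x‖ < ρ / 3 := (pi_norm_lt_iff (by positivity)).2 fun i ↦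
    (Complex.abs_re_le_norm (z i)).trans_lt ((norm_le_pi_norm z i).trans_lt hz)
  have hy : ‖y‖ < ρ / 3 := (pi_norm_lt_iff (by positivity)).2 fun i ↦
    (Complex.abs_im_le_norm (z i)).trans_lt ((norm_le_pi_norm z i).trans_lt hz)
  have hn : ∀ v : ι → ℝ, ‖ofRealPi ι v‖ = ‖v‖ := fun v ↦ by
    simp [Pi.norm_def]
  let g : ℂ → E := fun t ↦ f (ofRealPi ι x + t • ofRealPi ι y)
  have hg : AnalyticOnNhd ℂ g (Metric.ball 0 2) := by
    intro t ht
    rw [mem_ball_zero_iff] at ht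
    have hmem : ofRealPi ι x + t • ofRealPi ι y ∈ Metric.ball (0 : ι → ℂ) δ := by
      rw [mem_ball_zero_iff]
      calc ‖ofRealPi ι x + t • ofRealPi ι y‖ ≤ ‖x‖ + ‖t‖ * ‖y‖ := by
            refine (norm_add_le _ _).trans ?_
            rw [norm_smul, hn, hn]
        _ ≤ ‖x‖ + 2 * ‖y‖ := by gcongr
        _ < ρ := by linarith
        _ ≤ δ := min_le_left _ _
    refine AnalyticAt.comp (f := fun t : ℂ ↦ ofRealPi ι x + t • ofRealPi ι y) (hfδ _ hmem) ?_
    fun_prop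
  have hgr : ∀ t : ℝ, |t| < 2 → g t = 0 := by
    intro t ht
    have : ofRealPi ι x + (t : ℂ) • ofRealPi ι y = ofRealPi ι (x + t • y) := by
      ext i; simp
    simp only [g, this]
    refine hfε _ ?_
    rw [mem_ball_zero_iff]
    calc ‖x + t • y‖ ≤ ‖x‖ + |t| * ‖y‖ := by
          refine (norm_add_le _ _).trans ?_
          rw [norm_smul, Real.norm_eq_abs]
      _ ≤ ‖x‖ + 2 * ‖y‖ := by gcongr
      _ < ρ := by linarith
      _ ≤ ε := min_le_right _ _
  have hfreq : ∃ᶠ t in 𝓝[≠] (0 : ℂ), g t = 0 := by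
    have h1 : Filter.Tendsto (fun t : ℝ ↦ (t : ℂ)) (𝓝[≠] 0) (𝓝[≠] 0) := by
      refine tendsto_nhdsWithin_iff.2 ⟨?_, ?_⟩
      · exact (Complex.continuous_ofReal.tendsto' 0 0 (by simp)).mono_left nhdsWithin_le_nhds
      · filter_upwards [self_mem_nhdsWithin] with t ht
        simpa using ht
    refine h1.frequently (Filter.Eventually.frequently ?_)
    have : ∀ᶠ t : ℝ in 𝓝 0, |t| < 2 := by
      filter_upwards [Metric.ball_mem_nhds (0 : ℝ) (ε := 2) (by norm_num)] with t ht
      simpa using ht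
    filter_upwards [nhdsWithin_le_nhds this] with t ht using hgr t ht
  have h0 := hg.eqOn_zero_of_preconnected_of_frequently_eq_zero
    (convex_ball (0 : ℂ) 2).isPreconnected (Metric.mem_ball_self (by norm_num)) hfreq
    (show Complex.I ∈ Metric.ball (0 : ℂ) 2 by simp)
  have hz' : z = ofRealPi ι x + Complex.I • ofRealPi ι y := by
    ext i; simp [x, y, mul_comm Complex.I, Complex.re_add_im]
  rw [hz']
  exact h0

variable [DecidableEq ι]

/-- The power series over `ℂ^ι` with the same coefficients as the power series `p` over `ℝ^ι`: its
`n`-th term is the sum over `f : Fin n → ι` of the monomials `∏ i, (m i) (f i)` with coefficient the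
value of `p n` on the corresponding basis vectors. -/
noncomputable def FormalMultilinearSeries.complexifyPi (p : FormalMultilinearSeries ℝ (ι → ℝ) E) :
    FormalMultilinearSeries ℂ (ι → ℂ) E := fun n ↦
  ∑ f : Fin n → ι, ((ContinuousMultilinearMap.mkPiAlgebra ℂ (Fin n) ℂ).compContinuousLinearMap
    fun i ↦ ContinuousLinearMap.proj (f i)).smulRight (p n fun i ↦ Pi.single (f i) 1)

theorem FormalMultilinearSeries.complexifyPi_apply (p : FormalMultilinearSeries ℝ (ι → ℝ) E)
    (n : ℕ) (r : ι → ℝ) :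
    p.complexifyPi n (fun _ ↦ ofRealPi ι r) = p n fun _ ↦ r := by
  have hr : (fun _ : Fin n ↦ r) =
      fun _ : Fin n ↦ ∑ j : ι, r j • (Pi.single j 1 : ι → ℝ) := by
    funext i j
    simp [Finset.sum_apply, Pi.single_apply]
  rw [hr, (p n).map_sum]
  simp only [complexifyPi, sum_apply]
  refine Finset.sum_congr rfl fun f _ ↦ ?_
  rw [(p n).map_smul_univ]
  simp [← Complex.ofReal_prod]

theorem FormalMultilinearSeries.norm_complexifyPi_le (p : FormalMultilinearSeries ℝ (ι → ℝ) E)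
    (n : ℕ) : ‖p.complexifyPi n‖ ≤ (Fintype.card ι : ℝ) ^ n * ‖p n‖ := by
  have h1 : (Fintype.card ι : ℝ) ^ n * ‖p n‖ = ∑ _f : Fin n → ι, ‖p n‖ := by simp
  rw [h1]
  refine (norm_sum_le _ _).trans (Finset.sum_le_sum fun f _ ↦ ?_)
  refine ContinuousMultilinearMap.opNorm_le_bound (norm_nonneg _) fun m ↦ ?_
  have h2 : ‖p n fun i ↦ (Pi.single (f i) 1 : ι → ℝ)‖ ≤ ‖p n‖ := by
    refine ((p n).le_opNorm _).trans ?_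
    refine mul_le_of_le_one_right (norm_nonneg _)
      (Finset.prod_le_one (fun _ _ ↦ norm_nonneg _) fun i _ ↦ ?_)
    refine (pi_norm_le_iff_of_nonneg zero_le_one).2 fun j ↦ ?_
    by_cases hj : j = f i <;> simp [hj]
  have h3 : ‖∏ i, m i (f i)‖ ≤ ∏ i, ‖m i‖ := by
    rw [norm_prod]
    exact Finset.prod_le_prod (by simp) fun i _ ↦ norm_le_pi_norm (m i) (f i)
  simp only [ContinuousMultilinearMap.smulRight_apply,
    ContinuousMultilinearMap.compContinuousLinearMap_apply,
    ContinuousMultilinearMap.mkPiAlgebra_apply, ContinuousLinearMap.proj_apply, norm_smul]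
  rw [mul_comm]
  refine mul_le_mul ?_ h3 (norm_nonneg _) (norm_nonneg _)
  exact h2

theorem FormalMultilinearSeries.radius_complexifyPi_pos
    (p : FormalMultilinearSeries ℝ (ι → ℝ) E) (hp : 0 < p.radius) :
    0 < p.complexifyPi.radius := by
  obtain ⟨r, hr0, hr⟩ := ENNReal.lt_iff_exists_nnreal_btwn.1 hp
  obtain ⟨C, -, hC⟩ := p.norm_mul_pow_le_of_lt_radius hr
  have hc : (0 : ℝ) < Fintype.card ι + 1 := by positivity
  have hr0 : 0 < r := by exact_mod_cast hr0
  have key : ((r / (Fintype.card ι + 1) : NNReal) : ENNReal) ≤ p.complexifyPi.radius := by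
    refine p.complexifyPi.le_radius_of_bound C fun n ↦ ?_
    refine le_trans ?_ (hC n)
    calc ‖p.complexifyPi n‖ * ((r / (Fintype.card ι + 1) : NNReal) : ℝ) ^ n
        ≤ ((Fintype.card ι : ℝ) + 1) ^ n * ‖p n‖ *
            ((r / (Fintype.card ι + 1) : NNReal) : ℝ) ^ n := by
          gcongr
          refine (p.norm_complexifyPi_le n).trans ?_
          gcongr
          linarith
      _ = ‖p n‖ * r ^ n := by
          push_cast
          rw [div_pow]
          field_simp
  exact lt_of_lt_of_le (by exact_mod_cast (by positivity)) key

/-- A real-analytic germ `ℝ^ι → E` with values in a complex Banach space is the restriction of a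
holomorphic germ `ℂ^ι → E`. -/
theorem AnalyticAt.exists_complexification [CompleteSpace E] {φ : (ι → ℝ) → E}
    (hφ : AnalyticAt ℝ φ 0) :
    ∃ Φ : (ι → ℂ) → E, AnalyticAt ℂ Φ 0 ∧ ∀ᶠ r in 𝓝 0, Φ (ofRealPi ι r) = φ r := by
  obtain ⟨p, hp⟩ := hφ
  have hc := p.complexifyPi.hasFPowerSeriesOnBall (p.radius_complexifyPi_pos hp.radius_pos)
  refine ⟨_, hc.analyticAt, ?_⟩
  have h0 : Filter.Tendsto (ofRealPi ι) (𝓝 0) (𝓝 0) := by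
    simpa using (ofRealPi ι).continuous.tendsto 0
  filter_upwards [h0.eventually hc.hasFPowerSeriesAt.eventually_hasSum, hp.eventually_hasSum]
    with r h1 h2
  simp only [p.complexifyPi_apply, zero_add] at h1 h2
  exact h1.unique h2

end ComplexifyGerm

/-! ### Gluing germs along a subset -/

section GlueGerms

open TopologicalSpace

/-- Germs along a subset `Q` of a metrizable space that are locally induced by functions are induced
by one function on a neighbourhood of `Q`: on a locally finite closed refinement `C` of the cover
`U`, the set of points where all the relevant functions have the same germ is open. -/
theorem exists_glue_germs {M : Type*} [TopologicalSpace M] [PseudoMetrizableSpace M]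
    {β : M → Type*} [∀ x, Nonempty (β x)] {Q : Set M} {U : Q → Set M} (hU : ∀ q, IsOpen (U q))
    (hQU : ∀ q : Q, (q : M) ∈ U q) (s : Q → (x : M) → β x)
    (hs : ∀ q q' : Q, ∀ x ∈ Q, x ∈ U q → x ∈ U q' → ∀ᶠ y in 𝓝 x, s q y = s q' y) :
    ∃ (W : Set M) (t : (x : M) → β x), IsOpen W ∧ Q ⊆ W ∧
      ∀ x ∈ W, ∃ q, x ∈ U q ∧ ∀ᶠ y in 𝓝 x, t y = s q y := by
  classical
  let Ω : Set M := ⋃ q, U q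
  have hΩ : IsOpen Ω := isOpen_iUnion hU
  let _ : PseudoMetricSpace M := pseudoMetrizableSpacePseudoMetric M
  obtain ⟨v, hvo, hvc, hvf, hvU⟩ := precise_refinement (X := Ω) (fun q ↦ Subtype.val ⁻¹' U q)
    (fun q ↦ (hU q).preimage continuous_subtype_val) (by
      ext ⟨x, hx⟩
      simpa [Ω] using hx)
  obtain ⟨C, hCc, hC, hCv⟩ := exists_iUnion_eq_closed_subset hvo (fun x ↦ hvf.point_finite x) hvc
  have hCf : LocallyFinite C := hvf.subset hCv
  have hex : ∀ x : Ω, ∃ q, x ∈ C q := fun x ↦ mem_iUnion.1 (hCc ▸ mem_univ x)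
  choose idx hidx using hex
  let t : (x : M) → β x := fun x ↦
    if h : x ∈ Ω then s (idx ⟨x, h⟩) x else Classical.arbitrary _
  let W' : Set Ω := {x | ∀ i j, x ∈ C i → x ∈ C j → ∀ᶠ y in 𝓝 (x : M), s i y = s j y}
  have hfin : ∀ x : Ω, {i | x ∈ C i}.Finite := fun x ↦ hCf.point_finite x
  have hnear : ∀ x : Ω, ∀ᶠ y in 𝓝 x, ∀ i, y ∈ C i → x ∈ C i := fun x ↦ by
    filter_upwards [hCf.iInter_compl_mem_nhds hC x] with y hy i hi
    by_contra hxi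
    exact mem_iInter₂.1 hy i hxi hi
  have hW' : IsOpen W' := by
    rw [isOpen_iff_mem_nhds]
    intro x hx
    have h1 : ∀ᶠ y : Ω in 𝓝 x, ∀ i ∈ {i | x ∈ C i}, ∀ j ∈ {i | x ∈ C i},
        ∀ᶠ z in 𝓝 (y : M), s i z = s j z := by
      rw [Filter.eventually_all_finite (hfin x)]
      intro i hi
      rw [Filter.eventually_all_finite (hfin x)]
      intro j hj
      exact continuous_subtype_val.continuousAt.eventually (hx i j hi hj).eventually_nhds
    filter_upwards [h1, hnear x] with y hy1 hy2 i j hi hj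
    exact hy1 i (hy2 i hi) j (hy2 j hj)
  refine ⟨Subtype.val '' W', t, hΩ.isOpenMap_subtype_val _ hW', ?_, ?_⟩
  · intro x hx
    have hxΩ : x ∈ Ω := mem_iUnion.2 ⟨⟨x, hx⟩, hQU ⟨x, hx⟩⟩
    exact ⟨⟨x, hxΩ⟩, fun i j hi hj ↦ hs i j x hx (hvU i (hCv i hi)) (hvU j (hCv j hj)), rfl⟩
  · rintro _ ⟨x, hx, rfl⟩
    refine ⟨idx x, hvU _ (hCv _ (hidx x)), ?_⟩
    have h1 : ∀ᶠ y in 𝓝 (x : M), ∀ i ∈ {i | x ∈ C i}, s i y = s (idx x) y :=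
      (Filter.eventually_all_finite (hfin x)).2 fun i hi ↦ hx i _ hi (hidx x)
    have h2 : ∀ᶠ y in 𝓝 (x : M), ∃ h : y ∈ Ω, ∀ i, (⟨y, h⟩ : Ω) ∈ C i → x ∈ C i := by
      rw [← map_nhds_subtype_coe_eq_nhds x.2 (hΩ.mem_nhds x.2), Filter.eventually_map]
      filter_upwards [hnear x] with y hy using ⟨y.2, hy⟩
    filter_upwards [h1, h2] with y hy1 ⟨hyΩ, hy2⟩
    simp only [t, hyΩ, dif_pos]
    exact hy1 _ (hy2 _ (hidx _))

end GlueGerms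

/-! ### Slice charts -/

section Charts

variable {𝕜 : Type*} [NontriviallyNormedField 𝕜]
  {E : Type*} [NormedAddCommGroup E] [NormedSpace 𝕜 E]
  {M : Type*} [TopologicalSpace M] [ChartedSpace E M]

theorem analyticAt_transition [CompleteSpace E] {e e' : OpenPartialHomeomorph M E}
    (he : e ∈ IsManifold.maximalAtlas 𝓘(𝕜, E) ω M) (he' : e' ∈ IsManifold.maximalAtlas 𝓘(𝕜, E) ω M)
    {p : M} (hp : p ∈ e.source) (hp' : p ∈ e'.source) :
    AnalyticAt 𝕜 (fun u ↦ e' (e.symm u)) (e p) := by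
  have h := contMDiffOn_of_mem_contDiffGroupoid (IsManifold.compatible_of_mem_maximalAtlas he he')
  have h1 : e p ∈ (e.symm.trans e').source := by simp [hp, hp']
  have h2 := (h _ h1).contMDiffAt ((e.symm.trans e').open_source.mem_nhds h1)
  exact h2.contDiffAt.analyticAt

/-- The change between two analytic charts has an invertible derivative. -/
theorem exists_hasStrictFDerivAt_transition [CompleteSpace E] {e e' : OpenPartialHomeomorph M E}
    (he : e ∈ IsManifold.maximalAtlas 𝓘(𝕜, E) ω M) (he' : e' ∈ IsManifold.maximalAtlas 𝓘(𝕜, E) ω M)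
    {p : M} (hp : p ∈ e.source) (hp' : p ∈ e'.source) :
    ∃ D : E ≃L[𝕜] E, HasStrictFDerivAt (fun u ↦ e' (e.symm u)) (D : E →L[𝕜] E) (e p) := by
  have h1 := (analyticAt_transition he he' hp hp').hasStrictFDerivAt
  have h2 := (analyticAt_transition he' he hp' hp).hasStrictFDerivAt
  have key : ∀ {e e' : OpenPartialHomeomorph M E} {A B : E →L[𝕜] E}, p ∈ e.source → p ∈ e'.source →
      HasStrictFDerivAt (fun u ↦ e' (e.symm u)) A (e p) →
      HasStrictFDerivAt (fun u ↦ e (e'.symm u)) B (e' p) → ∀ v, B (A v) = v := by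
    intro e e' A B hp hp' hA hB v
    have h3 : HasFDerivAt (fun u ↦ e (e'.symm (e' (e.symm u)))) (B.comp A) (e p) := by
      refine HasFDerivAt.comp (g := fun u ↦ e (e'.symm u)) (f := fun u ↦ e' (e.symm u))
        (e p) ?_ hA.hasFDerivAt
      simpa [hp] using hB.hasFDerivAt
    have h4 : (fun u ↦ e (e'.symm (e' (e.symm u)))) =ᶠ[𝓝 (e p)] id := by
      have h5 : ∀ᶠ u in 𝓝 (e p), e.symm u ∈ e'.source :=
        (e.tendsto_symm hp).eventually (e'.open_source.mem_nhds hp')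
      filter_upwards [h5, e.open_target.mem_nhds (e.map_source hp)] with u hu hu'
      simp [hu, hu']
    have h6 := (h3.congr_of_eventuallyEq h4.symm).unique (hasFDerivAt_id (e p))
    exact congrArg (fun f : E →L[𝕜] E ↦ f v) h6
  exact ⟨ContinuousLinearEquiv.equivOfInverse _ _ (key hp hp' h1 h2) (key hp' hp h2 h1), h1⟩

theorem IsSliceChart.mem_iff {S : Set M} {e : OpenPartialHomeomorph M E} {L : Submodule 𝕜 E}
    (h : IsSliceChart 𝕜 S e L) {x : M} (hx : x ∈ e.source) : x ∈ S ↔ e x ∈ L := by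
  have := Set.ext_iff.1 h.2 x
  simpa [hx] using this

theorem isSliceChart_iff {S : Set M} {e : OpenPartialHomeomorph M E} {L : Submodule 𝕜 E} :
    IsSliceChart 𝕜 S e L ↔ e ∈ IsManifold.maximalAtlas 𝓘(𝕜, E) ω M ∧
      ∀ x ∈ e.source, x ∈ S ↔ e x ∈ L := by
  refine ⟨fun h ↦ ⟨h.1, fun x hx ↦ h.mem_iff hx⟩, fun h ↦ ⟨h.1, ?_⟩⟩
  ext x
  simpa using h.2 x

theorem IsSliceChart.symm_mem {S : Set M} {e : OpenPartialHomeomorph M E} {L : Submodule 𝕜 E}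
    (h : IsSliceChart 𝕜 S e L) {u : E} (hu : u ∈ e.target) (huL : u ∈ L) : e.symm u ∈ S := by
  rw [h.mem_iff (e.map_target hu), e.right_inv hu]
  exact huL

/-- A slice chart of `S`, restricted to an open set on which `S` and `S'` coincide, is a slice chart
of `S'`. -/
theorem IsSliceChart.restr {S S' : Set M} {e : OpenPartialHomeomorph M E} {L : Submodule 𝕜 E}
    (h : IsSliceChart 𝕜 S e L) {O : Set M} (hO : IsOpen O) (hS : ∀ x ∈ O, x ∈ S ↔ x ∈ S') :
    IsSliceChart 𝕜 S' (e.restr O) L := by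
  rw [isSliceChart_iff] at h ⊢
  refine ⟨restr_mem_maximalAtlas _ h.1 hO, fun x hx ↦ ?_⟩
  rw [e.restr_source' O hO] at hx
  rw [← hS x hx.2, h.2 x hx.1]
  rfl

end Charts

section RestrictScalars

variable {E : Type*} [NormedAddCommGroup E] [NormedSpace ℂ E]
  {M : Type*} [TopologicalSpace M] [ChartedSpace E M]

variable (E) in
theorem contDiffGroupoid_complex_le_real :
    contDiffGroupoid ω 𝓘(ℂ, E) ≤ contDiffGroupoid ω 𝓘(ℝ, E) := by
  rw [contDiffGroupoid, contDiffGroupoid]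
  exact groupoid_of_pregroupoid_le _ _ fun f s hfs ↦ ContDiffOn.restrict_scalars ℝ hfs

theorem maximalAtlas_complex_subset_real :
    IsManifold.maximalAtlas 𝓘(ℂ, E) ω M ⊆ IsManifold.maximalAtlas 𝓘(ℝ, E) ω M :=
  StructureGroupoid.maximalAtlas_mono (contDiffGroupoid_complex_le_real E)

variable (E M) in
/-- A complex manifold is a real-analytic manifold. -/
theorem isManifold_real_of_complex [h : IsManifold 𝓘(ℂ, E) ω M] : IsManifold 𝓘(ℝ, E) ω M where
  compatible he he' := contDiffGroupoid_complex_le_real E (h.compatible he he')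

end RestrictScalars

/-! ### Tangent vectors and genericity -/

section Tangent

theorem HasDerivAt.mem_of_eventually_mem {E : Type*} [NormedAddCommGroup E] [NormedSpace ℝ E]
    {g : ℝ → E} {w : E} {t : ℝ} (hg : HasDerivAt g w t) {L : Submodule ℝ E}
    (hL : IsClosed (L : Set E)) (h : ∀ᶠ s in 𝓝 t, g s ∈ L) : w ∈ L := by
  refine hL.mem_of_tendsto (hasDerivAt_iff_tendsto_slope.1 hg) ?_
  filter_upwards [nhdsWithin_le_nhds h] with s hs
  exact L.smul_mem _ (L.sub_mem hs h.self_of_nhds)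

variable {E : Type*} [NormedAddCommGroup E] [NormedSpace ℂ E]
  {M : Type*} [TopologicalSpace M] [ChartedSpace E M]

theorem tangentVectors_mono {S N : Set M} (h : S ⊆ N) (p : M) :
    tangentVectors (E := E) S p ⊆ tangentVectors (E := E) N p :=
  fun _ ⟨γ, h0, hc, hS, hd⟩ ↦ ⟨γ, h0, hc, hS.mono fun _ ht ↦ h ht, hd⟩

/-- In the totally real case `T + i T` is a direct sum. -/
theorem eq_zero_of_add_I_smul_eq_zero {W : Submodule ℝ E}
    (hW : (W : Set E) ∩ Complex.I • (W : Set E) = {0}) {x y : E} (hx : x ∈ W) (hy : y ∈ W)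
    (h : x + Complex.I • y = 0) : x = 0 ∧ y = 0 := by
  have hx0 : x = 0 := by
    have : x ∈ (W : Set E) ∩ Complex.I • (W : Set E) := by
      refine ⟨hx, mem_smul_set.2 ⟨-y, W.neg_mem hy, ?_⟩⟩
      rw [smul_neg]
      exact (eq_neg_of_add_eq_zero_left h).symm
    rwa [hW] at this
  refine ⟨hx0, ?_⟩
  simpa [hx0] using h

variable [FiniteDimensional ℂ E]

/-- In a slice chart with slice `L`, the tangent vectors of `S` at `p` are the image of `L` under the
derivative of the coordinate change to the preferred chart at `p`. -/
theorem IsSliceChart.mem_tangentVectors_iff {𝕜 : Type*} [RCLike 𝕜] [NormedSpace 𝕜 E]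
    [IsScalarTower ℝ 𝕜 E] {S : Set M} {e : OpenPartialHomeomorph M E} {L : Submodule 𝕜 E}
    (h : IsSliceChart 𝕜 S e L) {p : M} (hp : p ∈ e.source) (hpS : p ∈ S) {D : E ≃L[𝕜] E}
    (hD : HasStrictFDerivAt (fun u ↦ chartAt E p (e.symm u)) (D : E →L[𝕜] E) (e p)) (v : E) :
    v ∈ tangentVectors (E := E) S p ↔ D.symm v ∈ L := by
  have : FiniteDimensional ℝ E := FiniteDimensional.complexToReal E
  have hpc : p ∈ (chartAt E p).source := mem_chart_source E p
  constructor
  · rintro ⟨γ, hγ0, hγc, hγS, hγ⟩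
    -- The inverse coordinate change is differentiable, with derivative `D.symm`.
    let f : OpenPartialHomeomorph E E := e.symm.trans (chartAt E p)
    have hf : e p ∈ f.source := by simp [f, hp]
    have hfp : f (e p) = chartAt E p p := by simp [f, hp]
    have hDs : HasFDerivAt f.symm (D.symm : E →L[𝕜] E) (chartAt E p p) := by
      refine f.hasFDerivAt_symm (hfp ▸ f.map_source hf) ?_
      rw [← hfp, f.left_inv hf]
      exact hD.hasFDerivAt
    have hDr : HasFDerivAt f.symm ((D.symm : E →L[𝕜] E).restrictScalars ℝ) (chartAt E p (γ 0)) := by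
      rw [hγ0]
      exact hDs.restrictScalars ℝ
    have hγ' := hDr.comp_hasDerivAt (0 : ℝ) (f := fun t ↦ chartAt E p (γ t)) hγ
    refine hγ'.mem_of_eventually_mem (L := L.restrictScalars ℝ)
      (Submodule.closed_of_finiteDimensional _) ?_
    have h1 : ∀ᶠ t in 𝓝 (0 : ℝ), γ t ∈ e.source ∩ (chartAt E p).source :=
      hγc.eventually ((e.open_source.inter (chartAt E p).open_source).mem_nhds
        (by rw [hγ0]; exact ⟨hp, hpc⟩))
    filter_upwards [hγS, h1] with t ht ht1
    have : (f.symm ∘ fun t ↦ chartAt E p (γ t)) t = e (γ t) := by simp [f, ht1.2]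
    rw [this]
    exact (h.mem_iff ht1.1).1 ht
  · intro hv
    have hcont : ContinuousAt (fun t : ℝ ↦ e p + t • D.symm v) 0 := by fun_prop
    have h0 : e p + (0 : ℝ) • D.symm v = e p := by simp
    have hcont' : ContinuousAt (fun t : ℝ ↦ e.symm (e p + t • D.symm v)) 0 := by
      refine ContinuousAt.comp (f := fun t : ℝ ↦ e p + t • D.symm v) ?_ hcont
      rw [h0]
      exact e.continuousAt_symm (e.map_source hp)
    refine ⟨fun t ↦ e.symm (e p + t • D.symm v), by simp [hp], hcont', ?_, ?_⟩
    · have h1 : ∀ᶠ t in 𝓝 (0 : ℝ), e p + t • D.symm v ∈ e.target :=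
        hcont.eventually (e.open_target.mem_nhds (by simpa using e.map_source hp))
      filter_upwards [h1] with t ht
      exact h.symm_mem ht (L.add_mem ((h.mem_iff hp).1 hpS) (L.smul_of_tower_mem t hv))
    · have h2 : HasDerivAt (fun t : ℝ ↦ e p + t • D.symm v) (D.symm v) 0 := by
        simpa using ((hasDerivAt_id (0 : ℝ)).smul_const (D.symm v)).const_add (e p)
      have hDr : HasFDerivAt (fun u ↦ chartAt E p (e.symm u))
          ((D : E →L[𝕜] E).restrictScalars ℝ) (e p + (0 : ℝ) • D.symm v) := by
        rw [h0]
        exact hD.hasFDerivAt.restrictScalars ℝ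
      simpa using! hDr.comp_hasDerivAt (0 : ℝ) h2

theorem IsSliceChart.exists_tangentSubmodule {𝕜 : Type*} [RCLike 𝕜] [NormedSpace 𝕜 E]
    [IsScalarTower ℝ 𝕜 E] [IsManifold 𝓘(𝕜, E) ω M]
    {S : Set M} {e : OpenPartialHomeomorph M E} {L : Submodule 𝕜 E}
    (h : IsSliceChart 𝕜 S e L) {p : M} (hp : p ∈ e.source) (hpS : p ∈ S) :
    ∃ W : Submodule 𝕜 E, (W : Set E) = tangentVectors (E := E) S p ∧
      Module.finrank 𝕜 W = Module.finrank 𝕜 L := by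
  have : CompleteSpace E := FiniteDimensional.complete ℂ E
  obtain ⟨D, hD⟩ := exists_hasStrictFDerivAt_transition h.1
    (IsManifold.chart_mem_maximalAtlas (I := 𝓘(𝕜, E)) (n := ω) p) hp (mem_chart_source E p)
  refine ⟨L.map (D.toLinearEquiv : E →ₗ[𝕜] E), ?_, LinearEquiv.finrank_map_eq D.toLinearEquiv L⟩
  ext v
  refine Iff.trans ?_ (h.mem_tangentVectors_iff hp hpS hD v).symm
  simp only [SetLike.mem_coe, Submodule.mem_map]
  exact ⟨fun ⟨u, hu, huv⟩ ↦ by rw [← huv]; simpa using! hu, fun hv ↦ ⟨_, hv, by simp⟩⟩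

theorem IsSubmanifold.exists_tangentSubmodule {𝕜 : Type*} [RCLike 𝕜] [NormedSpace 𝕜 E]
    [IsScalarTower ℝ 𝕜 E] [IsManifold 𝓘(𝕜, E) ω M] {k : ℕ} {S : Set M}
    (h : IsSubmanifold 𝕜 (E := E) k S) {p : M} (hpS : p ∈ S) :
    ∃ W : Submodule 𝕜 E, (W : Set E) = tangentVectors (E := E) S p ∧
      Module.finrank 𝕜 W = k := by
  obtain ⟨e, L, hp, hk, he⟩ := h p hpS
  obtain ⟨W, hW, hWL⟩ := he.exists_tangentSubmodule hp hpS
  exact ⟨W, hW, hWL.trans hk⟩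

/-- Every slice chart of a submanifold of dimension `k` has a slice of dimension `k`. -/
theorem IsSubmanifold.finrank_eq {𝕜 : Type*} [RCLike 𝕜] [NormedSpace 𝕜 E]
    [IsScalarTower ℝ 𝕜 E] [IsManifold 𝓘(𝕜, E) ω M] {k : ℕ} {S : Set M}
    (h : IsSubmanifold 𝕜 (E := E) k S) {e : OpenPartialHomeomorph M E} {L : Submodule 𝕜 E}
    (he : IsSliceChart 𝕜 S e L) {p : M} (hp : p ∈ e.source) (hpS : p ∈ S) :
    Module.finrank 𝕜 L = k := by
  obtain ⟨W, hW, hWk⟩ := h.exists_tangentSubmodule hpS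
  obtain ⟨W', hW', hWL⟩ := he.exists_tangentSubmodule hp hpS
  have : W = W' := SetLike.coe_injective (hW.trans hW'.symm)
  rw [← hWL, ← this, hWk]

/-- A totally real submanifold `Q` of dimension `k` is automatically generic in every complex
submanifold of dimension `k` containing it, by counting real dimensions. -/
theorem IsTotallyReal.isGenericIn [IsManifold 𝓘(ℂ, E) ω M] {k : ℕ} {Q N : Set M}
    (hQr : IsTotallyReal E Q) (hQ : IsSubmanifold ℝ (E := E) k Q)
    (hN : IsSubmanifold ℂ (E := E) k N) (hQN : Q ⊆ N) : IsGenericIn E Q N := by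
  intro p hp
  have : FiniteDimensional ℝ E := FiniteDimensional.complexToReal E
  have := isManifold_real_of_complex E M
  obtain ⟨W, hW, hWk⟩ := hQ.exists_tangentSubmodule hp
  obtain ⟨T, hT, hTk⟩ := hN.exists_tangentSubmodule (hQN hp)
  have hsub : W ≤ T.restrictScalars ℝ := fun v hv ↦ by
    have : v ∈ tangentVectors (E := E) Q p := hW ▸ hv
    have := tangentVectors_mono hQN p this
    rwa [← hT] at this
  have hr := hQr p hp
  let g : W × W →ₗ[ℝ] T.restrictScalars ℝ :=
    LinearMap.codRestrict _ (W.subtype.coprod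
      ((LinearMap.lsmul ℂ E Complex.I).restrictScalars ℝ ∘ₗ W.subtype)) fun x ↦
        (T.restrictScalars ℝ).add_mem (hsub x.1.2) (T.smul_mem Complex.I (hsub x.2.2))
  have hW' : (W : Set E) ∩ Complex.I • (W : Set E) = {0} := by rw [hW]; exact hr
  have hginj : Function.Injective g := by
    rw [← LinearMap.ker_eq_bot, LinearMap.ker_eq_bot']
    intro x hx
    have h0 : (x.1 : E) + Complex.I • (x.2 : E) = 0 := congrArg Subtype.val hx
    obtain ⟨h1, h2⟩ := eq_zero_of_add_I_smul_eq_zero hW' x.1.2 x.2.2 h0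
    exact Prod.ext (Subtype.ext h1) (Subtype.ext h2)
  have hdim : Module.finrank ℝ (W × W) = Module.finrank ℝ (T.restrictScalars ℝ) := by
    rw [Module.finrank_prod, hWk]
    have : Module.finrank ℝ T = 2 * Module.finrank ℂ T := finrank_real_of_complex T
    rw [hTk] at this
    exact (two_mul k).symm.trans this.symm
  have hsurj : Function.Surjective g :=
    (LinearMap.injective_iff_surjective_of_finrank_eq_finrank hdim).1 hginj
  refine Eq.trans ?_ hT
  have hW2 := hW.symm
  ext v
  constructor
  · rintro ⟨a, ha, b, hb, rfl⟩
    obtain ⟨b, hb', rfl⟩ := mem_smul_set.1 hb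
    exact (g (⟨a, by rw [hW2] at ha; exact ha⟩, ⟨b, by rw [hW2] at hb'; exact hb'⟩)).2
  · intro hv
    obtain ⟨x, hx⟩ := hsurj ⟨v, hv⟩
    rw [← hW]
    exact ⟨(x.1 : E), x.1.2, Complex.I • (x.2 : E), smul_mem_smul_set x.2.2,
      congrArg Subtype.val hx⟩

end Tangent

/-! ### Complex parametrizations -/

section Parametrization

/-- A slice chart parametrizes the submanifold near each point by its slice. -/
theorem IsSliceChart.map_nhds {𝕜 : Type*} [NontriviallyNormedField 𝕜]
    {E : Type*} [NormedAddCommGroup E] [NormedSpace 𝕜 E]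
    {M : Type*} [TopologicalSpace M] [ChartedSpace E M]
    {S : Set M} {e : OpenPartialHomeomorph M E} {L : Submodule 𝕜 E} (h : IsSliceChart 𝕜 S e L)
    {u : L} (hu : (u : E) ∈ e.target) :
    Filter.map (fun v : L ↦ e.symm (v : E)) (𝓝 u) = 𝓝[S] (e.symm (u : E)) := by
  have h1 : 𝓝[e.symm ⁻¹' S] (u : E) = 𝓝[(L : Set E)] (u : E) := by
    rw [nhdsWithin_eq_iff_eventuallyEq]
    filter_upwards [e.open_target.mem_nhds hu] with v hv
    have := h.mem_iff (e.map_target hv)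
    rw [e.right_inv hv] at this
    exact propext this
  have h2 := e.symm.map_nhdsWithin_preimage_eq (x := (u : E)) hu S
  rw [← h2, h1, ← map_nhds_subtype_val, Filter.map_map]
  rfl

variable {E : Type*} [NormedAddCommGroup E] [NormedSpace ℂ E]
  {M : Type*} [TopologicalSpace M] [ChartedSpace E M] {k : ℕ}

/-- `Φ` is a holomorphic map on a neighbourhood of `0` in `ℂ^k`, written in the preferred chart at
`q`, which is an immersion at `0` and whose restriction to `ℝ^k` parametrizes `Q` near `q`. The last
property, that small balls of `ℝ^k` are mapped into `Q` and onto neighbourhoods of `q` in `Q`, is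
expressed by filters. -/
structure IsComplexParametrization (Q : Set M) (q : M) (Φ : (Fin k → ℂ) → E) : Prop where
  map_zero : Φ 0 = chartAt E q q
  analyticAt : AnalyticAt ℂ Φ 0
  injective_fderiv : Function.Injective (fderiv ℂ Φ 0)
  map_nhds : Filter.map (fun r ↦ (chartAt E q).symm (Φ (ofRealPi (Fin k) r))) (𝓝 0) = 𝓝[Q] q

theorem IsComplexParametrization.contMDiffAt [CompleteSpace E] [IsManifold 𝓘(ℂ, E) ω M]
    {Q : Set M} {q : M} {Φ : (Fin k → ℂ) → E} (h : IsComplexParametrization Q q Φ) :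
    ContMDiffAt 𝓘(ℂ, Fin k → ℂ) 𝓘(ℂ, E) ω (fun z ↦ (chartAt E q).symm (Φ z)) 0 := by
  refine ContMDiffAt.comp (g := (chartAt E q).symm) (f := Φ) (I' := 𝓘(ℂ, E)) 0 ?_
    h.analyticAt.contDiffAt.contMDiffAt
  rw [h.map_zero]
  exact contMDiffAt_symm_of_mem_maximalAtlas (IsManifold.chart_mem_maximalAtlas q)
    (mem_chart_target E q)

theorem tendsto_ofRealPi_zero {ι : Type*} : Filter.Tendsto (ofRealPi ι) (𝓝 0) (𝓝 0) := by
  simpa using (ofRealPi ι).continuous.tendsto 0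

variable [FiniteDimensional ℂ E]

/-- A complex parametrization along `Q` also parametrizes, near `q`, every complex submanifold `N` of
dimension `k` that contains `Q` near `q`. -/
theorem IsComplexParametrization.map_nhds_eq [IsManifold 𝓘(ℂ, E) ω M] {Q : Set M} {q : M}
    {Φ : (Fin k → ℂ) → E} (h : IsComplexParametrization Q q Φ) {N : Set M}
    {e : OpenPartialHomeomorph M E} {L : Submodule ℂ E} (he : IsSliceChart ℂ N e L)
    (hq : q ∈ e.source) (hL : Module.finrank ℂ L = k) (hQN : ∀ᶠ x in 𝓝[Q] q, x ∈ N) :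
    Filter.map (fun z ↦ (chartAt E q).symm (Φ z)) (𝓝 0) = 𝓝[N] q := by
  have : CompleteSpace E := FiniteDimensional.complete ℂ E
  set c := chartAt E q
  have hqc : q ∈ c.source := mem_chart_source E q
  have hcmax := IsManifold.chart_mem_maximalAtlas (I := 𝓘(ℂ, E)) (n := ω) q
  obtain ⟨D, hD⟩ := exists_hasStrictFDerivAt_transition hcmax he.1 hqc hq
  have hDa := analyticAt_transition hcmax he.1 hqc hq
  let f : (Fin k → ℂ) → E := fun z ↦ e (c.symm (Φ z))
  have hfa : AnalyticAt ℂ f 0 := by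
    refine AnalyticAt.comp (g := fun u ↦ e (c.symm u)) (f := Φ) ?_ h.analyticAt
    rw [h.map_zero]
    exact hDa
  have hf' : HasFDerivAt f ((D : E →L[ℂ] E).comp (fderiv ℂ Φ 0)) 0 := by
    refine HasFDerivAt.comp (g := fun u ↦ e (c.symm u)) (f := Φ) 0 ?_
      h.analyticAt.differentiableAt.hasFDerivAt
    rw [h.map_zero]
    exact hD.hasFDerivAt
  have hΦ0 : c.symm (Φ 0) = q := by rw [h.map_zero]; exact c.left_inv hqc
  have hΦc : Filter.Tendsto (fun z ↦ c.symm (Φ z)) (𝓝 0) (𝓝 q) := by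
    have := h.contMDiffAt.continuousAt.tendsto
    rwa [show (chartAt E q).symm (Φ 0) = q from hΦ0] at this
  have hsrc : ∀ᶠ z in 𝓝 0, c.symm (Φ z) ∈ e.source := hΦc.eventually (e.open_source.mem_nhds hq)
  obtain ⟨P₀, hP₀⟩ := LinearMap.exists_leftInverse_of_injective L.subtype L.ker_subtype
  let P : E →L[ℂ] L := LinearMap.toContinuousLinearMap P₀
  have hP : ∀ v : L, P v = v := fun v ↦ congrArg (fun g : L →ₗ[ℂ] L ↦ g v) hP₀
  -- The component of `f` transverse to the slice vanishes on `ℝ^k`, hence everywhere.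
  have hfL : ∀ᶠ z in 𝓝 0, f z - P (f z) = 0 := by
    refine AnalyticAt.eventually_eq_zero_of_ofRealPi (f := fun z ↦ f z - P (f z)) ?_ ?_
    · exact hfa.fun_sub (((L.subtypeL.comp P).analyticAt (f 0)).comp hfa)
    · have h1 : ∀ᶠ r in 𝓝 0, c.symm (Φ (ofRealPi (Fin k) r)) ∈ N := by
        have h2 := hQN
        rwa [← h.map_nhds, Filter.eventually_map] at h2
      filter_upwards [h1, tendsto_ofRealPi_zero.eventually hsrc] with r hr1 hr2
      have h3 : f (ofRealPi (Fin k) r) ∈ L := (he.mem_iff hr2).1 hr1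
      rw [hP ⟨_, h3⟩, sub_self]
  have hfL' : ∀ᶠ z in 𝓝 0, f z = P (f z) := hfL.mono fun z hz ↦ sub_eq_zero.1 hz
  -- Seen in the slice, `f` has an injective derivative between spaces of dimension `k`, so it is open.
  let g : (Fin k → ℂ) → L := fun z ↦ P (f z)
  have hga : AnalyticAt ℂ g 0 := (P.analyticAt (f 0)).comp hfa
  have hg' : HasFDerivAt g (P.comp ((D : E →L[ℂ] E).comp (fderiv ℂ Φ 0))) 0 :=
    P.hasFDerivAt.comp 0 hf'
  have hff : (D : E →L[ℂ] E).comp (fderiv ℂ Φ 0) =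
      L.subtypeL.comp (P.comp ((D : E →L[ℂ] E).comp (fderiv ℂ Φ 0))) :=
    hf'.unique ((L.subtypeL.hasFDerivAt.comp 0 hg').congr_of_eventuallyEq hfL')
  have hginj : Function.Injective (P.comp ((D : E →L[ℂ] E).comp (fderiv ℂ Φ 0))) := by
    have h1 : Function.Injective ((D : E →L[ℂ] E).comp (fderiv ℂ Φ 0)) :=
      D.injective.comp h.injective_fderiv
    rw [hff] at h1
    exact Function.Injective.of_comp (f := L.subtypeL) h1
  have hgsurj : Function.Surjective (P.comp ((D : E →L[ℂ] E).comp (fderiv ℂ Φ 0))) :=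
    (LinearMap.injective_iff_surjective_of_finrank_eq_finrank (by simp [hL])).1 hginj
  have hgmap : Filter.map g (𝓝 0) = 𝓝 (g 0) := by
    refine HasStrictFDerivAt.map_nhds_eq_of_surj
      (f' := P.comp ((D : E →L[ℂ] E).comp (fderiv ℂ Φ 0))) ?_ (LinearMap.range_eq_top.2 hgsurj)
    rw [← hg'.fderiv]
    exact hga.hasStrictFDerivAt
  have hg0 : ((g 0 : L) : E) = e q := by
    rw [← hfL'.self_of_nhds]
    simp only [f, hΦ0]
  have hcongr : (fun z ↦ c.symm (Φ z)) =ᶠ[𝓝 0] (fun v : L ↦ e.symm (v : E)) ∘ g := by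
    filter_upwards [hfL', hsrc] with z hz1 hz2
    simp only [Function.comp, g]
    rw [← hz1]
    exact (e.left_inv hz2).symm
  rw [Filter.map_congr hcongr, ← Filter.map_map, hgmap,
    he.map_nhds (by rw [hg0]; exact e.map_source hq), hg0, e.left_inv hq]

end Parametrization

/-! ### Holomorphic sections and local uniqueness -/

section AnalyticSections

theorem extendByZero_of_mem {M : Type*} {V : M → Type*} [∀ x, Zero (V x)] {S : Set M}
    (X : (x : S) → V x) {x : M} (hx : x ∈ S) : extendByZero X x = X ⟨x, hx⟩ := dif_pos hx

theorem Bundle.Trivialization.eq_of_snd_eq {M F : Type*} {V : M → Type*} [TopologicalSpace M]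
    [TopologicalSpace F] [TopologicalSpace (TotalSpace F V)] [∀ x, Zero (V x)]
    (t : Trivialization F (TotalSpace.proj : TotalSpace F V → M))
    {x : M} (hx : x ∈ t.baseSet) {v w : V x} (h : (t ⟨x, v⟩).2 = (t ⟨x, w⟩).2) : v = w := by
  rw [← t.symm_apply_apply_mk hx v, h, t.symm_apply_apply_mk hx w]

variable (𝕜 : Type*) [NontriviallyNormedField 𝕜]
  {E : Type*} [NormedAddCommGroup E] [NormedSpace 𝕜 E]
  {M : Type*} [TopologicalSpace M] [ChartedSpace E M]
  (F : Type*) [NormedAddCommGroup F] [NormedSpace 𝕜 F]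
  {V : M → Type*} [TopologicalSpace (TotalSpace F V)]
  [∀ x, TopologicalSpace (V x)] [FiberBundle F V]

/-- The restriction to the submanifold `S` of the section `Y` of `V`, itself of no regularity, is
`𝕜`-analytic near `p`: it is analytic in the coordinates given by a slice chart at `p`. -/
def IsAnalyticAlongAt (S : Set M) (Y : (x : M) → V x) (p : M) : Prop :=
  ∃ (e : OpenPartialHomeomorph M E) (L : Submodule 𝕜 E),
    p ∈ e.source ∧ IsSliceChart 𝕜 S e L ∧
    ContMDiffOn 𝓘(𝕜, L) (𝓘(𝕜, E).prod 𝓘(𝕜, F)) ω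
      (fun u : L ↦ TotalSpace.mk' F (e.symm (u : E)) (Y (e.symm (u : E))))
      {u : L | (u : E) ∈ e.target}

variable {𝕜 F}

theorem IsAnalyticAlongAt.congr {S S' : Set M} {Y Y' : (x : M) → V x} {p : M}
    (h : IsAnalyticAlongAt 𝕜 (E := E) F S Y p) {O : Set M} (hO : IsOpen O) (hp : p ∈ O)
    (hS : ∀ x ∈ O, x ∈ S ↔ x ∈ S') (hY : ∀ x ∈ O, x ∈ S → Y x = Y' x) :
    IsAnalyticAlongAt 𝕜 (E := E) F S' Y' p := by
  obtain ⟨e, L, hpe, he, hYe⟩ := h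
  refine ⟨e.restr O, L, ?_, he.restr hO hS, ?_⟩
  · rw [e.restr_source' O hO]
    exact ⟨hpe, hp⟩
  · have hsub : ∀ u : L, (u : E) ∈ (e.restr O).target → (u : E) ∈ e.target ∧ e.symm (u : E) ∈ O := by
      intro u hu
      have h1 := (e.restr O).map_target hu
      rw [e.restr_source' O hO] at h1
      exact ⟨hu.1, h1.2⟩
    refine (hYe.mono fun u hu ↦ (hsub u hu).1).congr fun u hu ↦ ?_
    obtain ⟨h1, h2⟩ := hsub u hu
    exact congrArg (TotalSpace.mk' F (e.symm (u : E))) (hY _ h2 (he.symm_mem h1 u.2)).symm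

theorem isAnalyticSection_iff [∀ x, Zero (V x)] {S : Set M} {X : (x : S) → V x} :
    IsAnalyticSection 𝕜 (E := E) F X ↔
      ∀ p ∈ S, IsAnalyticAlongAt 𝕜 (E := E) F S (extendByZero X) p := Iff.rfl

end AnalyticSections

section Holomorphic

variable {E : Type*} [NormedAddCommGroup E] [NormedSpace ℂ E] [FiniteDimensional ℂ E]
  {M : Type*} [TopologicalSpace M] [ChartedSpace E M]
  {F : Type*} [NormedAddCommGroup F] [NormedSpace ℂ F]
  {V : M → Type*} [TopologicalSpace (TotalSpace F V)]
  [∀ x, TopologicalSpace (V x)] [FiberBundle F V]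
  {Z : Type*} [NormedAddCommGroup Z] [NormedSpace ℂ Z]

/-- A holomorphic section over `N`, composed with a holomorphic map into `N`, is holomorphic. -/
theorem IsAnalyticAlongAt.contMDiffAt_comp {N : Set M} {Y : (x : M) → V x} {g : Z → M} {z : Z}
    (hY : IsAnalyticAlongAt ℂ (E := E) F N Y (g z)) (hg : ContMDiffAt 𝓘(ℂ, Z) 𝓘(ℂ, E) ω g z)
    (hgN : ∀ᶠ w in 𝓝 z, g w ∈ N) :
    ContMDiffAt 𝓘(ℂ, Z) (𝓘(ℂ, E).prod 𝓘(ℂ, F)) ω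
      (fun w ↦ TotalSpace.mk' F (g w) (Y (g w))) z := by
  obtain ⟨e, L, hpe, he, hYe⟩ := hY
  obtain ⟨P₀, hP₀⟩ := LinearMap.exists_leftInverse_of_injective L.subtype L.ker_subtype
  let P : E →L[ℂ] L := LinearMap.toContinuousLinearMap P₀
  have hP : ∀ v : L, P v = v := fun v ↦ congrArg (fun g : L →ₗ[ℂ] L ↦ g v) hP₀
  -- The coordinates of `g` in the slice chart `e`.
  let f : Z → L := fun w ↦ P (e (g w))
  have hf : ContMDiffAt 𝓘(ℂ, Z) 𝓘(ℂ, L) ω f z :=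
    P.contMDiff.contMDiffAt.comp z ((contMDiffAt_of_mem_maximalAtlas he.1 hpe).comp z hg)
  have hfe : ∀ᶠ w in 𝓝 z, e.symm (f w : E) = g w := by
    filter_upwards [hgN, hg.continuousAt.eventually (e.open_source.mem_nhds hpe)] with w hw1 hw2
    have h1 : e (g w) ∈ L := (he.mem_iff hw2).1 hw1
    have h2 : (f w : E) = e (g w) := congrArg Subtype.val (hP ⟨_, h1⟩)
    rw [h2, e.left_inv hw2]
  have hfz : (f z : E) = e (g z) :=
    congrArg Subtype.val (hP ⟨_, (he.mem_iff hpe).1 hgN.self_of_nhds⟩)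
  have hopen : IsOpen {u : L | (u : E) ∈ e.target} :=
    e.open_target.preimage continuous_subtype_val
  have hmem : f z ∈ {u : L | (u : E) ∈ e.target} := by
    change (f z : E) ∈ e.target
    rw [hfz]
    exact e.map_source hpe
  refine (((hYe _ hmem).contMDiffAt (hopen.mem_nhds hmem)).comp z hf).congr_of_eventuallyEq ?_
  filter_upwards [hfe] with w hw
  change TotalSpace.mk' F (g w) (Y (g w)) =
    TotalSpace.mk' F (e.symm (f w : E)) (Y (e.symm (f w : E)))
  rw [hw]

variable [∀ x, AddCommGroup (V x)] [∀ x, Module ℂ (V x)] [VectorBundle ℂ F V]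
  [ContMDiffVectorBundle ω F V 𝓘(ℂ, E)]

theorem IsAnalyticAlongAt.analyticAt_comp [CompleteSpace F] {N : Set M} {Y : (x : M) → V x}
    {g : Z → M} {z : Z}
    (hY : IsAnalyticAlongAt ℂ (E := E) F N Y (g z)) (hg : ContMDiffAt 𝓘(ℂ, Z) 𝓘(ℂ, E) ω g z)
    (hgN : ∀ᶠ w in 𝓝 z, g w ∈ N) (t : Trivialization F (TotalSpace.proj : TotalSpace F V → M))
    [MemTrivializationAtlas t] (ht : g z ∈ t.baseSet) :
    AnalyticAt ℂ (fun w ↦ (t ⟨g w, Y (g w)⟩).2) z := by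
  have h := hY.contMDiffAt_comp hg hgN
  rw [t.contMDiffAt_iff (t.mem_source.2 ht)] at h
  exact h.2.contDiffAt.analyticAt

/-- Local uniqueness of the complexification and of the holomorphic extension of a section. -/
theorem IsComplexParametrization.germ_unique [IsManifold 𝓘(ℂ, E) ω M] [FiniteDimensional ℂ F]
    {k : ℕ} {Q : Set M} {q : M} {Φ : (Fin k → ℂ) → E} (h : IsComplexParametrization Q q Φ) {N₁ N₂ : Set M}
    {e₁ e₂ : OpenPartialHomeomorph M E} {L₁ L₂ : Submodule ℂ E}
    (he₁ : IsSliceChart ℂ N₁ e₁ L₁) (he₂ : IsSliceChart ℂ N₂ e₂ L₂)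
    (hq₁ : q ∈ e₁.source) (hq₂ : q ∈ e₂.source) (hL₁ : Module.finrank ℂ L₁ = k)
    (hL₂ : Module.finrank ℂ L₂ = k) (hQN₁ : ∀ᶠ x in 𝓝[Q] q, x ∈ N₁) (hQN₂ : ∀ᶠ x in 𝓝[Q] q, x ∈ N₂)
    {Y₁ Y₂ : (x : M) → V x} (hY₁ : IsAnalyticAlongAt ℂ (E := E) F N₁ Y₁ q)
    (hY₂ : IsAnalyticAlongAt ℂ (E := E) F N₂ Y₂ q) (hY : ∀ᶠ x in 𝓝[Q] q, Y₁ x = Y₂ x) :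
    ∀ᶠ x in 𝓝 q, (x ∈ N₁ ↔ x ∈ N₂) ∧ (x ∈ N₁ → Y₁ x = Y₂ x) := by
  have : CompleteSpace E := FiniteDimensional.complete ℂ E
  have : CompleteSpace F := FiniteDimensional.complete ℂ F
  have h1 := h.map_nhds_eq he₁ hq₁ hL₁ hQN₁
  have h2 := h.map_nhds_eq he₂ hq₂ hL₂ hQN₂
  have hΦ0 : (chartAt E q).symm (Φ 0) = q := by
    rw [h.map_zero]
    exact (chartAt E q).left_inv (mem_chart_source E q)
  set g : (Fin k → ℂ) → M := fun z ↦ (chartAt E q).symm (Φ z)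
  have hg0 : g 0 = q := hΦ0
  have hgN : ∀ {N : Set M}, Filter.map g (𝓝 0) = 𝓝[N] q → ∀ᶠ z in 𝓝 0, g z ∈ N := fun {N} hN ↦ by
    have : ∀ᶠ x in 𝓝[N] q, x ∈ N := self_mem_nhdsWithin
    rwa [← hN] at this
  let t := trivializationAt F V q
  have hqt : q ∈ t.baseSet := mem_baseSet_trivializationAt F V q
  have ha : ∀ {N : Set M} {Y : (x : M) → V x}, Filter.map g (𝓝 0) = 𝓝[N] q →
      IsAnalyticAlongAt ℂ (E := E) F N Y q → AnalyticAt ℂ (fun z ↦ (t ⟨g z, Y (g z)⟩).2) 0 :=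
    fun hN hY ↦ IsAnalyticAlongAt.analyticAt_comp (g := g) (z := 0) (by rw [hg0]; exact hY)
      h.contMDiffAt (hgN hN) t (by rw [hg0]; exact hqt)
  have hzero : ∀ᶠ z in 𝓝 0, (t ⟨g z, Y₁ (g z)⟩).2 - (t ⟨g z, Y₂ (g z)⟩).2 = 0 := by
    refine AnalyticAt.eventually_eq_zero_of_ofRealPi ((ha h1 hY₁).fun_sub (ha h2 hY₂)) ?_
    rw [← h.map_nhds, Filter.eventually_map] at hY
    filter_upwards [hY] with r hr
    have hr' : Y₁ (g (ofRealPi (Fin k) r)) = Y₂ (g (ofRealPi (Fin k) r)) := hr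
    rw [hr', sub_self]
  have hbase : ∀ᶠ z in 𝓝 0, g z ∈ t.baseSet := by
    refine h.contMDiffAt.continuousAt.eventually (t.open_baseSet.mem_nhds ?_)
    change g 0 ∈ t.baseSet
    rw [hg0]
    exact hqt
  have hYN : ∀ᶠ x in 𝓝[N₁] q, Y₁ x = Y₂ x := by
    rw [← h1, Filter.eventually_map]
    filter_upwards [hzero, hbase] with z hz1 hz2
    exact t.eq_of_snd_eq hz2 (sub_eq_zero.1 hz1)
  have hN : 𝓝[N₁] q = 𝓝[N₂] q := h1.symm.trans h2
  filter_upwards [nhdsWithin_eq_iff_eventuallyEq.1 hN, eventually_nhdsWithin_iff.1 hYN]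
    with x hx1 hx2
  exact ⟨Iff.of_eq hx1, hx2⟩

end Holomorphic

/-! ### Local existence -/

section LocalExistence

variable {E : Type*} [NormedAddCommGroup E] [NormedSpace ℂ E] [FiniteDimensional ℂ E]
  {M : Type*} [TopologicalSpace M] [ChartedSpace E M] [IsManifold 𝓘(ℂ, E) ω M]
  {F : Type*} [NormedAddCommGroup F] [NormedSpace ℂ F] [FiniteDimensional ℂ F]
  {V : M → Type*} [TopologicalSpace (TotalSpace F V)]
  [∀ x, TopologicalSpace (V x)] [FiberBundle F V]

/-- A totally real submanifold has a complex parametrization at each point, in which a given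
real-analytic section has holomorphic coordinates `y`: both are obtained by complexifying power
series. The immersion property of `Φ` is the total reality of `Q`. -/
theorem exists_isComplexParametrization {k : ℕ} {Q : Set M} (hQ : IsSubmanifold ℝ (E := E) k Q)
    (hQr : IsTotallyReal E Q) {X : (x : M) → V x} {q : M} (hq : q ∈ Q)
    (hX : IsAnalyticAlongAt ℝ (E := E) F Q X q) :
    ∃ (Φ : (Fin k → ℂ) → E) (y : (Fin k → ℂ) → F), IsComplexParametrization Q q Φ ∧
      AnalyticAt ℂ y 0 ∧ ∀ᶠ r in 𝓝 0,
        (trivializationAt F V q ⟨(chartAt E q).symm (Φ (ofRealPi (Fin k) r)),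
          X ((chartAt E q).symm (Φ (ofRealPi (Fin k) r)))⟩).2 = y (ofRealPi (Fin k) r) := by
  have : CompleteSpace E := FiniteDimensional.complete ℂ E
  have : CompleteSpace F := FiniteDimensional.complete ℂ F
  have : FiniteDimensional ℝ E := FiniteDimensional.complexToReal E
  have := isManifold_real_of_complex E M
  obtain ⟨e, L, hqe, he, hXe⟩ := hX
  have hLk : Module.finrank ℝ L = k := hQ.finrank_eq he hqe hq
  set c := chartAt E q
  have hqc : q ∈ c.source := mem_chart_source E q
  have hcmax := IsManifold.chart_mem_maximalAtlas (I := 𝓘(ℝ, E)) (n := ω) q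
  let lin : (Fin k → ℝ) ≃L[ℝ] L := ContinuousLinearEquiv.ofFinrankEq (by simp [hLk])
  let u₀ : L := ⟨e q, (he.mem_iff hqe).1 hq⟩
  let ℓ : (Fin k → ℝ) → L := fun r ↦ u₀ + lin r
  have hℓ0 : ℓ 0 = u₀ := by simp [ℓ]
  have hℓa : AnalyticAt ℝ ℓ 0 := by
    exact analyticAt_const.add ((lin : (Fin k → ℝ) →L[ℝ] L).analyticAt 0)
  have hℓ' : HasFDerivAt ℓ (lin : (Fin k → ℝ) →L[ℝ] L) 0 := by
    exact (lin : (Fin k → ℝ) →L[ℝ] L).hasFDerivAt.const_add u₀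
  have hℓmap : Filter.map ℓ (𝓝 0) = 𝓝 u₀ := by
    rw [← hℓ0]
    exact (lin.toHomeomorph.trans (Homeomorph.addLeft u₀)).map_nhds_eq 0
  have hu₀ : (u₀ : E) ∈ e.target := e.map_source hqe
  have hsrc : ∀ᶠ r in 𝓝 0, e.symm (ℓ r : E) ∈ c.source := by
    have h1 : ContinuousAt (fun r ↦ e.symm (ℓ r : E)) 0 := by
      refine ContinuousAt.comp (g := e.symm) (f := fun r ↦ (ℓ r : E)) ?_
        (continuous_subtype_val.continuousAt.comp hℓa.continuousAt)
      rw [hℓ0]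
      exact e.continuousAt_symm hu₀
    refine h1.eventually (c.open_source.mem_nhds ?_)
    change e.symm (ℓ 0 : E) ∈ c.source
    rw [hℓ0]
    simpa [u₀, hqe] using hqc
  obtain ⟨D, hD⟩ := exists_hasStrictFDerivAt_transition he.1 hcmax hqe hqc
  let φ : (Fin k → ℝ) → E := fun r ↦ c (e.symm (ℓ r : E))
  have hφa : AnalyticAt ℝ φ 0 := by
    refine AnalyticAt.comp (g := fun u ↦ c (e.symm u)) (f := fun r ↦ (ℓ r : E)) ?_
      ((L.subtypeL.analyticAt _).comp hℓa)
    rw [hℓ0]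
    exact analyticAt_transition he.1 hcmax hqe hqc
  have hφ' : HasFDerivAt φ ((D : E →L[ℝ] E).comp (L.subtypeL.comp
      (lin : (Fin k → ℝ) →L[ℝ] L))) 0 := by
    refine HasFDerivAt.comp (g := fun u ↦ c (e.symm u)) (f := fun r ↦ (ℓ r : E)) 0 ?_
      (L.subtypeL.hasFDerivAt.comp 0 hℓ')
    rw [hℓ0]
    exact hD.hasFDerivAt
  have hφ0 : φ 0 = c q := by simp [φ, hℓ0, u₀, hqe]
  obtain ⟨Φ, hΦa, hΦφ⟩ := hφa.exists_complexification
  have hΦ' := hΦa.differentiableAt.hasFDerivAt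
  have hsymm : ∀ᶠ r in 𝓝 0, c.symm (Φ (ofRealPi (Fin k) r)) = e.symm (ℓ r : E) := by
    filter_upwards [hΦφ, hsrc] with r hr1 hr2
    rw [hr1]
    exact c.left_inv hr2
  have hψ : ContMDiffAt 𝓘(ℝ, Fin k → ℝ) (𝓘(ℝ, E).prod 𝓘(ℝ, F)) ω
      (fun r ↦ TotalSpace.mk' F (e.symm (ℓ r : E)) (X (e.symm (ℓ r : E)))) 0 := by
    have hopen : IsOpen {u : L | (u : E) ∈ e.target} :=
      e.open_target.preimage continuous_subtype_val
    refine ContMDiffAt.comp (I' := 𝓘(ℝ, L))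
      (g := fun u : L ↦ TotalSpace.mk' F (e.symm (u : E)) (X (e.symm (u : E)))) 0 ?_
      hℓa.contDiffAt.contMDiffAt
    rw [hℓ0]
    exact (hXe _ hu₀).contMDiffAt (hopen.mem_nhds hu₀)
  have hxa : AnalyticAt ℝ (fun r ↦
      (trivializationAt F V q ⟨e.symm (ℓ r : E), X (e.symm (ℓ r : E))⟩).2) 0 := by
    have h1 := (contMDiffAt_totalSpace.1 hψ).2
    have h2 : e.symm (ℓ 0 : E) = q := by simp [hℓ0, u₀, hqe]
    simp only [h2] at h1
    exact h1.contDiffAt.analyticAt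
  obtain ⟨y, hya, hyx⟩ := hxa.exists_complexification
  refine ⟨Φ, y, ⟨?_, hΦa, ?_, ?_⟩, hya, ?_⟩
  · have := hΦφ.self_of_nhds
    rw [map_zero, hφ0] at this
    exact this
  · -- On `ℝ^k` the derivative of `Φ` takes values in the tangent space of `Q`.
    have hcomp : ∀ r, fderiv ℂ Φ 0 (ofRealPi (Fin k) r) = D (lin r : E) := by
      have h1 : HasFDerivAt (fun r ↦ Φ (ofRealPi (Fin k) r))
          (((fderiv ℂ Φ 0).restrictScalars ℝ).comp (ofRealPi (Fin k))) 0 := by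
        refine HasFDerivAt.comp (g := Φ) 0 ?_ (ofRealPi (Fin k)).hasFDerivAt
        rw [map_zero]
        exact hΦ'.restrictScalars ℝ
      intro r
      exact congrArg (fun f : (Fin k → ℝ) →L[ℝ] E ↦ f r)
        ((h1.congr_of_eventuallyEq (hΦφ.mono fun r hr ↦ hr.symm)).unique hφ')
    obtain ⟨W, hW, -⟩ := he.exists_tangentSubmodule hqe hq
    have hDW : ∀ v : L, D (v : E) ∈ W := fun v ↦ by
      have h1 : D (v : E) ∈ tangentVectors (E := E) Q q :=
        (he.mem_tangentVectors_iff hqe hq hD _).2 (by simp)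
      rw [← hW] at h1
      exact h1
    have hW' : (W : Set E) ∩ Complex.I • (W : Set E) = {0} := by
      rw [hW]
      exact hQr q hq
    rw [injective_iff_map_eq_zero]
    intro z hz
    obtain ⟨a, b, rfl⟩ := exists_eq_ofRealPi_add z
    rw [map_add, map_smul, hcomp, hcomp] at hz
    obtain ⟨h1, h2⟩ := eq_zero_of_add_I_smul_eq_zero hW' (hDW _) (hDW _) hz
    have hinj : ∀ r, D (lin r : E) = 0 → r = 0 := fun r hr ↦ by simpa using hr
    rw [hinj a h1, hinj b h2]
    simp
  · have h1 : (fun r ↦ c.symm (Φ (ofRealPi (Fin k) r))) =ᶠ[𝓝 0]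
        (fun v : L ↦ e.symm (v : E)) ∘ ℓ := hsymm
    rw [Filter.map_congr h1, ← Filter.map_map, hℓmap, he.map_nhds hu₀]
    simp only [u₀, e.left_inv hqe]
  · filter_upwards [hyx, hsymm] with r hr1 hr2
    rw [hr2, hr1]

variable [∀ x, AddCommGroup (V x)] [∀ x, Module ℂ (V x)] [VectorBundle ℂ F V]
  [ContMDiffVectorBundle ω F V 𝓘(ℂ, E)]

/-- Local existence of a complexification `N` of `Q` and of a holomorphic extension `Y` of `X`.
With `A` the derivative of the parametrization `Φ` at `0` and `B` a left inverse of `A`, the map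
`v ↦ Φ (B v) + (v - A (B v))` has derivative `1` and straightens the image of `Φ` to the range
of `A`. -/
theorem exists_local_extension {k : ℕ} {Q : Set M} (hQ : IsSubmanifold ℝ (E := E) k Q)
    (hQr : IsTotallyReal E Q) {X : (x : M) → V x} {q : M} (hq : q ∈ Q)
    (hX : IsAnalyticAlongAt ℝ (E := E) F Q X q) :
    ∃ (e : OpenPartialHomeomorph M E) (L : Submodule ℂ E) (N : Set M) (Y : (x : M) → V x),
      q ∈ e.source ∧ Module.finrank ℂ L = k ∧ IsSliceChart ℂ N e L ∧
      (∀ x ∈ Q, x ∈ e.source → x ∈ N ∧ Y x = X x) ∧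
      ContMDiffOn 𝓘(ℂ, L) (𝓘(ℂ, E).prod 𝓘(ℂ, F)) ω
        (fun u : L ↦ TotalSpace.mk' F (e.symm (u : E)) (Y (e.symm (u : E))))
        {u : L | (u : E) ∈ e.target} := by
  have : CompleteSpace E := FiniteDimensional.complete ℂ E
  have : CompleteSpace F := FiniteDimensional.complete ℂ F
  obtain ⟨Φ, y, hΦ, hya, hyX⟩ := exists_isComplexParametrization hQ hQr hq hX
  set c := chartAt E q
  have hqc : q ∈ c.source := mem_chart_source E q
  have hcmax := IsManifold.chart_mem_maximalAtlas (I := 𝓘(ℂ, E)) (n := ω) q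
  set t := trivializationAt F V q
  have hqt : q ∈ t.baseSet := mem_baseSet_trivializationAt F V q
  let A : (Fin k → ℂ) →L[ℂ] E := fderiv ℂ Φ 0
  have hAker : LinearMap.ker (A : (Fin k → ℂ) →ₗ[ℂ] E) = ⊥ :=
    LinearMap.ker_eq_bot.2 hΦ.injective_fderiv
  obtain ⟨B₀, hB₀⟩ := LinearMap.exists_leftInverse_of_injective
    (A : (Fin k → ℂ) →ₗ[ℂ] E) hAker
  let B : E →L[ℂ] (Fin k → ℂ) := LinearMap.toContinuousLinearMap B₀
  have hBA : ∀ z, B (A z) = z := fun z ↦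
    congrArg (fun g : (Fin k → ℂ) →ₗ[ℂ] (Fin k → ℂ) ↦ g z) hB₀
  let L : Submodule ℂ E := LinearMap.range (A : (Fin k → ℂ) →ₗ[ℂ] E)
  have hL : Module.finrank ℂ L = k := by
    rw [LinearMap.finrank_range_of_inj hΦ.injective_fderiv]
    simp
  let Ψ : E → E := fun v ↦ Φ (B v) + (v - A (B v))
  have hΨA : ∀ z, Ψ (A z) = Φ z := fun z ↦ by simp [Ψ, hBA]
  have hΨa : AnalyticAt ℂ Ψ 0 := by
    have h1 : AnalyticAt ℂ (fun v ↦ Φ (B v)) 0 := by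
      refine AnalyticAt.comp (g := Φ) (f := B) ?_ (B.analyticAt 0)
      rw [map_zero]
      exact hΦ.analyticAt
    exact h1.fun_add (analyticAt_id.fun_sub ((A.comp B).analyticAt 0))
  have hΨ' : HasFDerivAt Ψ ((ContinuousLinearEquiv.refl ℂ E : E ≃L[ℂ] E) : E →L[ℂ] E) 0 := by
    have h1 : HasFDerivAt (fun v ↦ Φ (B v)) (A.comp B) 0 := by
      refine HasFDerivAt.comp (g := Φ) (f := B) 0 ?_ B.hasFDerivAt
      rw [map_zero]
      exact hΦ.analyticAt.differentiableAt.hasFDerivAt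
    have h2 := h1.add ((hasFDerivAt_id (0 : E)).sub (A.comp B).hasFDerivAt)
    rw [add_sub_cancel] at h2
    exact h2
  have hΨc : ContDiffAt ℂ ω Ψ 0 := hΨa.contDiffAt
  let ψ := hΨc.toOpenPartialHomeomorph Ψ hΨ' (by simp)
  have hψ : ∀ v, ψ v = Ψ v := fun v ↦ rfl
  have h0ψ : (0 : E) ∈ ψ.source :=
    hΨc.mem_toOpenPartialHomeomorph_source hΨ' (by simp)
  have hψ0 : ψ 0 = c q := by
    rw [hψ, ← map_zero A, hΨA, hΦ.map_zero]
  have hcqψ : c q ∈ ψ.target := hψ0 ▸ ψ.map_source h0ψ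
  have hψc0 : ψ.symm (c q) = 0 := by rw [← hψ0, ψ.left_inv h0ψ]
  have hψsa : AnalyticAt ℂ ψ.symm (c q) := by
    refine ψ.analyticAt_symm (i := ContinuousLinearEquiv.refl ℂ E) hcqψ ?_ ?_
    · rw [hψc0]
      exact hΨa
    · rw [hψc0]
      exact hΨ'.fderiv
  let e₀ := c.trans ψ.symm
  have he₀q : e₀ q = 0 := hψc0
  have hqe₀ : q ∈ e₀.source := by
    rw [OpenPartialHomeomorph.trans_source]
    exact ⟨hqc, hcqψ⟩
  have he₀c : Filter.Tendsto e₀ (𝓝 q) (𝓝 0) := he₀q ▸ e₀.continuousAt hqe₀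
  let Y : (x : M) → V x := fun x ↦ t.symm x (y (B (e₀ x)))
  -- Everything holds near `q`; the chart is then restricted to such a neighbourhood.
  have hnear : ∀ᶠ x in 𝓝 q, AnalyticAt ℂ ψ.symm (c x) ∧ AnalyticAt ℂ Ψ (e₀ x) ∧
      x ∈ t.baseSet ∧ AnalyticAt ℂ y (B (e₀ x)) ∧ (x ∈ Q → e₀ x ∈ L ∧ Y x = X x) := by
    have h1 : ∀ᶠ x in 𝓝 q, AnalyticAt ℂ ψ.symm (c x) :=
      (c.continuousAt hqc).eventually hψsa.eventually_analyticAt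
    have h2 : ∀ᶠ x in 𝓝 q, AnalyticAt ℂ Ψ (e₀ x) :=
      he₀c.eventually hΨa.eventually_analyticAt
    have h3 : ∀ᶠ x in 𝓝 q, x ∈ t.baseSet := t.open_baseSet.mem_nhds hqt
    have h4 : ∀ᶠ x in 𝓝 q, AnalyticAt ℂ y (B (e₀ x)) := by
      have hB0 : Filter.Tendsto B (𝓝 0) (𝓝 0) := by simpa using B.continuous.tendsto 0
      exact (hB0.comp he₀c).eventually hya.eventually_analyticAt
    have h5 : ∀ᶠ x in 𝓝[Q] q, e₀ x ∈ L ∧ (x ∈ t.baseSet → Y x = X x) := by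
      rw [← hΦ.map_nhds, Filter.eventually_map]
      have hA0 : Filter.Tendsto (fun r ↦ A (ofRealPi (Fin k) r)) (𝓝 0) (𝓝 0) := by
        simpa [Function.comp_def] using (A.continuous.tendsto 0).comp tendsto_ofRealPi_zero
      have hΦt : ∀ᶠ r in 𝓝 0, Φ (ofRealPi (Fin k) r) ∈ c.target := by
        have h6 : Filter.Tendsto Φ (𝓝 0) (𝓝 (c q)) := by
          have := hΦ.analyticAt.continuousAt.tendsto
          rwa [hΦ.map_zero] at this
        exact (h6.comp tendsto_ofRealPi_zero).eventually
          (c.open_target.mem_nhds (c.map_source hqc))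
      filter_upwards [hA0.eventually (ψ.open_source.mem_nhds h0ψ), hΦt, hyX] with r hr1 hr2 hr3
      have h7 : e₀ (c.symm (Φ (ofRealPi (Fin k) r))) = A (ofRealPi (Fin k) r) := by
        change ψ.symm (c (c.symm (Φ (ofRealPi (Fin k) r)))) = _
        rw [c.right_inv hr2, ← hΨA, ← hψ, ψ.left_inv hr1]
      refine ⟨by rw [h7]; exact ⟨_, rfl⟩, fun hrt ↦ ?_⟩
      simp only [Y]
      rw [h7, hBA, ← hr3, t.symm_apply_apply_mk hrt]
    filter_upwards [h1, h2, h3, h4, eventually_nhdsWithin_iff.1 h5] with x hx1 hx2 hx3 hx4 hx5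
    exact ⟨hx1, hx2, hx3, hx4, fun hxQ ↦ ⟨(hx5 hxQ).1, (hx5 hxQ).2 hx3⟩⟩
  obtain ⟨O, hO, hOo, hqO⟩ := mem_nhds_iff.1 hnear
  have hsrc : ∀ x ∈ (e₀.restr O).source, x ∈ c.source ∧ c x ∈ ψ.target ∧ x ∈ O := fun x hx ↦ by
    rw [e₀.restr_source' O hOo, OpenPartialHomeomorph.trans_source] at hx
    exact ⟨hx.1.1, hx.1.2, hx.2⟩
  have htgt : ∀ u ∈ (e₀.restr O).target, u ∈ ψ.source ∧ ψ u ∈ c.target ∧ e₀.symm u ∈ O ∧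
      e₀ (e₀.symm u) = u := fun u hu ↦ by
    have h1 := (hsrc _ ((e₀.restr O).map_target hu)).2.2
    have h2 : u ∈ e₀.target := hu.1
    have h3 := e₀.right_inv h2
    rw [OpenPartialHomeomorph.trans_target] at h2
    exact ⟨h2.1, h2.2, h1, h3⟩
  have hsymm : ∀ u ∈ (e₀.restr O).target,
      ContMDiffAt 𝓘(ℂ, E) 𝓘(ℂ, E) ω (e₀.restr O).symm u := fun u hu ↦ by
    obtain ⟨h1, h2, h3, h4⟩ := htgt u hu
    have h5 : AnalyticAt ℂ Ψ u := h4 ▸ (hO h3).2.1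
    exact ContMDiffAt.comp (I' := 𝓘(ℂ, E)) (g := c.symm) (f := Ψ) u
      (contMDiffAt_symm_of_mem_maximalAtlas hcmax h2) h5.contDiffAt.contMDiffAt
  have hmax : e₀.restr O ∈ IsManifold.maximalAtlas 𝓘(ℂ, E) ω M := by
    refine OpenPartialHomeomorph.mem_maximalAtlas_of_contMDiffOn _ (fun x hx ↦ ?_)
      fun u hu ↦ (hsymm u hu).contMDiffWithinAt
    obtain ⟨h1, h2, h3⟩ := hsrc x hx
    exact (ContMDiffAt.comp (I' := 𝓘(ℂ, E)) (g := ψ.symm) (f := c) x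
      (hO h3).1.contDiffAt.contMDiffAt
      (contMDiffAt_of_mem_maximalAtlas hcmax h1)).contMDiffWithinAt
  have hqs : q ∈ (e₀.restr O).source := by
    rw [e₀.restr_source' O hOo]
    exact ⟨hqe₀, hqO⟩
  refine ⟨e₀.restr O, L, {x | e₀ x ∈ L}, Y, hqs, hL,
    isSliceChart_iff.2 ⟨hmax, fun x _ ↦ Iff.rfl⟩,
    fun x hxQ hx ↦ (hO (hsrc x hx).2.2).2.2.2.2 hxQ, fun u hu ↦ ContMDiffAt.contMDiffWithinAt ?_⟩
  obtain ⟨h1, h2, h3, h4⟩ := htgt u hu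
  have hbase : ∀ᶠ v : L in 𝓝 u, (v : E) ∈ (e₀.restr O).target :=
    continuous_subtype_val.continuousAt.eventually ((e₀.restr O).open_target.mem_nhds hu)
  rw [t.contMDiffAt_iff (t.mem_source.2 (hO h3).2.2.1)]
  refine ⟨(hsymm u hu).comp u L.subtypeL.contMDiff.contMDiffAt, ?_⟩
  have h5 : AnalyticAt ℂ (fun v : L ↦ y (B (v : E))) u := by
    refine AnalyticAt.comp (g := y) (f := fun v : L ↦ B (v : E)) ?_
      ((B.comp L.subtypeL).analyticAt u)
    have := (hO h3).2.2.2.1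
    rwa [h4] at this
  refine h5.contDiffAt.contMDiffAt.congr_of_eventuallyEq ?_
  filter_upwards [hbase] with v hv
  obtain ⟨-, -, h6, h7⟩ := htgt v hv
  have h8 := t.apply_mk_symm (hO h6).2.2.1 (y (B (e₀ (e₀.symm (v : E)))))
  rw [h7] at h8
  have h9 : Y (e₀.symm (v : E)) = t.symm (e₀.symm (v : E)) (y (B (v : E))) := by
    simp only [Y]
    rw [h7]
  change (t ⟨e₀.symm (v : E), Y (e₀.symm (v : E))⟩).2 = _
  rw [h9, h8]

end LocalExistence

/-! ### Globalization -/

section Global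

/-- A slice chart can be restricted to a small one whose target is a ball. -/
theorem IsSliceChart.exists_target_eq_ball {𝕜 : Type*} [NontriviallyNormedField 𝕜]
    {E : Type*} [NormedAddCommGroup E] [NormedSpace 𝕜 E]
    {M : Type*} [TopologicalSpace M] [ChartedSpace E M]
    {S : Set M} {e : OpenPartialHomeomorph M E} {L : Submodule 𝕜 E} (h : IsSliceChart 𝕜 S e L)
    {q : M} (hq : q ∈ e.source) {O : Set M} (hO : IsOpen O) (hqO : q ∈ O) :
    ∃ (f : OpenPartialHomeomorph M E) (ρ : ℝ), 0 < ρ ∧ q ∈ f.source ∧ f.source ⊆ O ∧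
      IsSliceChart 𝕜 S f L ∧ f.target = Metric.ball (f q) ρ := by
  have hn : e.target ∩ e.symm ⁻¹' O ∈ 𝓝 (e q) :=
    (e.symm.isOpen_inter_preimage hO).mem_nhds
      ⟨e.map_source hq, by rw [mem_preimage, e.left_inv hq]; exact hqO⟩
  obtain ⟨ρ, hρ, hb⟩ := Metric.mem_nhds_iff.1 hn
  have hopen : IsOpen (e.source ∩ e ⁻¹' Metric.ball (e q) ρ) :=
    e.isOpen_inter_preimage Metric.isOpen_ball
  have hsrc : (e.restr (e.source ∩ e ⁻¹' Metric.ball (e q) ρ)).source =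
      e.source ∩ e ⁻¹' Metric.ball (e q) ρ := by
    rw [e.restr_source' _ hopen]
    exact inter_eq_right.2 inter_subset_left
  refine ⟨e.restr (e.source ∩ e ⁻¹' Metric.ball (e q) ρ), ρ, hρ, ?_, ?_,
    h.restr hopen fun _ _ ↦ Iff.rfl, ?_⟩
  · rw [hsrc]
    exact ⟨hq, Metric.mem_ball_self hρ⟩
  · rw [hsrc]
    intro x hx
    have := (hb hx.2).2
    rwa [mem_preimage, e.left_inv hx.1] at this
  · change _ = Metric.ball (e q) ρ
    rw [← OpenPartialHomeomorph.image_source_eq_target, hsrc]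
    ext u
    constructor
    · rintro ⟨x, hx, rfl⟩
      exact hx.2
    · intro hu
      have hut : u ∈ e.target := (hb hu).1
      refine ⟨e.symm u, ⟨e.map_target hut, ?_⟩, e.right_inv hut⟩
      rw [mem_preimage, e.right_inv hut]
      exact hu

variable {E : Type*} [NormedAddCommGroup E] [NormedSpace ℂ E] [FiniteDimensional ℂ E]
  {M : Type*} [TopologicalSpace M] [ChartedSpace E M] [IsManifold 𝓘(ℂ, E) ω M]
  {F : Type*} [NormedAddCommGroup F] [NormedSpace ℂ F] [FiniteDimensional ℂ F]
  {V : M → Type*} [TopologicalSpace (TotalSpace F V)]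
  [∀ x, AddCommGroup (V x)] [∀ x, Module ℂ (V x)]
  [∀ x, TopologicalSpace (V x)] [FiberBundle F V] [VectorBundle ℂ F V]
  [ContMDiffVectorBundle ω F V 𝓘(ℂ, E)]
  {k : ℕ} {Q : Set M} {X : (x : Q) → V x}

/-- Two complexifications of `Q` with holomorphic extensions of the same real-analytic section agree
near each point of `Q`. -/
theorem IsComplexification.eventually_eq (hX : IsAnalyticSection ℝ (E := E) F X) {N N' : Set M}
    (hN : IsComplexification E k Q N) (hN' : IsComplexification E k Q N')
    {Y : (x : N) → V x} {Y' : (x : N') → V x}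
    (hY : IsAnalyticSection ℂ (E := E) F Y) (hYX : IsExtensionOf Y X)
    (hY' : IsAnalyticSection ℂ (E := E) F Y') (hYX' : IsExtensionOf Y' X) {q : M} (hq : q ∈ Q) :
    ∀ᶠ x in 𝓝 q, (x ∈ N ↔ x ∈ N') ∧ (x ∈ N → extendByZero Y x = extendByZero Y' x) := by
  obtain ⟨Φ, -, hΦ, -⟩ := exists_isComplexParametrization hN.isRealSubmanifold hN.isTotallyReal hq
    (isAnalyticSection_iff.1 hX q hq)
  obtain ⟨e, L, hqe, hL, he⟩ := hN.isComplexSubmanifold q (hN.subset hq)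
  obtain ⟨e', L', hqe', hL', he'⟩ := hN'.isComplexSubmanifold q (hN'.subset hq)
  refine hΦ.germ_unique he he' hqe hqe' hL hL'
    (eventually_nhdsWithin_of_forall fun x hx ↦ hN.subset hx)
    (eventually_nhdsWithin_of_forall fun x hx ↦ hN'.subset hx)
    (isAnalyticSection_iff.1 hY q (hN.subset hq)) (isAnalyticSection_iff.1 hY' q (hN'.subset hq))
    (eventually_nhdsWithin_of_forall fun x hx ↦ ?_)
  rw [extendByZero_of_mem Y (hN.subset hx), extendByZero_of_mem Y' (hN'.subset hx),
    hYX.2 x hx, hYX'.2 x hx]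

/-- A holomorphic extension of `X` to a complexification `N` is unique when `N` is covered by slice
charts centred at points of `Q`, with balls as targets, over each of which `V` is trivial. -/
theorem IsComplexification.extension_unique (hX : IsAnalyticSection ℝ (E := E) F X) {N : Set M}
    (hN : IsComplexification E k Q N)
    (hcov : ∀ x ∈ N, ∃ q ∈ Q, ∃ (f : OpenPartialHomeomorph M E) (L : Submodule ℂ E) (ρ : ℝ),
      0 < ρ ∧ IsSliceChart ℂ N f L ∧ q ∈ f.source ∧ x ∈ f.source ∧
      f.source ⊆ (trivializationAt F V q).baseSet ∧ f.target = Metric.ball (f q) ρ)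
    {Y Y' : (x : N) → V x}
    (hY : IsAnalyticSection ℂ (E := E) F Y) (hYX : IsExtensionOf Y X)
    (hY' : IsAnalyticSection ℂ (E := E) F Y') (hYX' : IsExtensionOf Y' X) : Y = Y' := by
  have : CompleteSpace F := FiniteDimensional.complete ℂ F
  funext ⟨x, hx⟩
  rw [← extendByZero_of_mem Y hx, ← extendByZero_of_mem Y' hx]
  obtain ⟨q, hq, f, L, ρ, hρ, hf, hqf, hxf, hft, hball⟩ := hcov x hx
  set t := trivializationAt F V q
  let u₀ : L := ⟨f q, (hf.mem_iff hqf).1 (hN.subset hq)⟩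
  let u : L := ⟨f x, (hf.mem_iff hxf).1 hx⟩
  have hmem : ∀ v : L, v ∈ Metric.ball u₀ ρ ↔ (v : E) ∈ f.target := fun v ↦ by
    rw [hball]
    exact Iff.rfl
  have han : ∀ {Z : (x : N) → V x}, IsAnalyticSection ℂ (E := E) F Z →
      AnalyticOnNhd ℂ (fun v : L ↦ (t ⟨f.symm (v : E), extendByZero Z (f.symm (v : E))⟩).2)
        (Metric.ball u₀ ρ) := by
    intro Z hZ v hv
    rw [hmem] at hv
    refine IsAnalyticAlongAt.analyticAt_comp (g := fun v : L ↦ f.symm (v : E))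
      (isAnalyticSection_iff.1 hZ _ (hf.symm_mem hv v.2)) ?_ ?_ t (hft (f.map_target hv))
    · exact (contMDiffAt_symm_of_mem_maximalAtlas hf.1 hv).comp v
        L.subtypeL.contMDiff.contMDiffAt
    · filter_upwards [continuous_subtype_val.continuousAt.eventually
        (f.open_target.mem_nhds hv)] with w hw using hf.symm_mem hw w.2
  have hev : ∀ᶠ v : L in 𝓝 u₀, (t ⟨f.symm (v : E), extendByZero Y (f.symm (v : E))⟩).2 =
      (t ⟨f.symm (v : E), extendByZero Y' (f.symm (v : E))⟩).2 := by
    have h1 : Filter.Tendsto (fun v : L ↦ f.symm (v : E)) (𝓝 u₀) (𝓝[N] q) := by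
      have := hf.map_nhds (u := u₀) (f.map_source hqf)
      rw [show f.symm (u₀ : E) = q from f.left_inv hqf] at this
      exact this.le
    have h2 := eventually_nhdsWithin_iff.2
      ((hN.eventually_eq hX hN hY hYX hY' hYX' hq).mono fun x hx ↦ hx.2)
    filter_upwards [h1.eventually h2] with v hv
    rw [hv]
  have heq := (han hY).eqOn_of_preconnected_of_eventuallyEq (han hY')
    (convex_ball u₀ ρ).isPreconnected (Metric.mem_ball_self hρ) hev
    ((hmem u).2 (f.map_source hxf))
  have hfu : f.symm (u : E) = x := f.left_inv hxf
  have heq' : (t ⟨f.symm (u : E), extendByZero Y (f.symm (u : E))⟩).2 =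
      (t ⟨f.symm (u : E), extendByZero Y' (f.symm (u : E))⟩).2 := heq
  rw [hfu] at heq'
  exact t.eq_of_snd_eq (hft hxf) heq'

/-- Local complexifications with local extensions, glued near `Q`: by local uniqueness their germs
agree along `Q`, so that `exists_glue_germs` applies. -/
theorem exists_glued_extension [T2Space M] [SecondCountableTopology M]
    (hQ : IsSubmanifold ℝ (E := E) k Q) (hQr : IsTotallyReal E Q)
    (hX : IsAnalyticSection ℝ (E := E) F X) :
    ∃ (W N : Set M) (Y : (x : M) → V x), IsOpen W ∧ Q ⊆ W ∧
      (∀ x ∈ W, ∃ (e : OpenPartialHomeomorph M E) (L : Submodule ℂ E),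
        x ∈ e.source ∧ Module.finrank ℂ L = k ∧ IsSliceChart ℂ N e L) ∧
      (∀ x ∈ W, IsAnalyticAlongAt ℂ (E := E) F N Y x) ∧
      ∀ x ∈ Q, x ∈ N ∧ Y x = extendByZero X x := by
  classical
  have : ProperSpace E := FiniteDimensional.proper ℂ E
  have : LocallyCompactSpace M := ChartedSpace.locallyCompactSpace E M
  have : TopologicalSpace.MetrizableSpace M :=
    TopologicalSpace.metrizableSpace_of_t3_secondCountable M
  have hX' := isAnalyticSection_iff.1 hX
  have hloc := fun q : Q ↦ exists_local_extension hQ hQr q.2 (hX' q q.2)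
  choose e L N Y hqe hL he hQN hY using hloc
  -- The pair of `N q` and `Y q` is encoded as a function on `M`.
  let s : Q → (x : M) → Prop × V x := fun q x ↦ (x ∈ N q, if x ∈ N q then Y q x else 0)
  have hs : ∀ q q' : Q, ∀ x ∈ Q, x ∈ (e q).source → x ∈ (e q').source →
      ∀ᶠ y in 𝓝 x, s q y = s q' y := by
    intro q q' x hx hxq hxq'
    obtain ⟨Φ, -, hΦ, -⟩ := exists_isComplexParametrization hQ hQr hx (hX' x hx)
    have hQe : ∀ q : Q, x ∈ (e q).source →
        ∀ᶠ y in 𝓝[Q] x, y ∈ N q ∧ Y q y = extendByZero X y := fun q hxq ↦ by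
      filter_upwards [self_mem_nhdsWithin, nhdsWithin_le_nhds ((e q).open_source.mem_nhds hxq)]
        with y hy1 hy2 using hQN q y hy1 hy2
    have h1 := hΦ.germ_unique (he q) (he q') hxq hxq' (hL q) (hL q')
      ((hQe q hxq).mono fun y hy ↦ hy.1) ((hQe q' hxq').mono fun y hy ↦ hy.1)
      ⟨e q, L q, hxq, he q, hY q⟩ ⟨e q', L q', hxq', he q', hY q'⟩
      (by filter_upwards [hQe q hxq, hQe q' hxq'] with y hy hy' using hy.2.trans hy'.2.symm)
    filter_upwards [h1] with y hy
    by_cases hyN : y ∈ N q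
    · simp [s, hyN, hy.1.1 hyN, hy.2 hyN]
    · have hyN' : y ∉ N q' := fun h ↦ hyN (hy.1.2 h)
      simp [s, hyN, hyN']
  obtain ⟨W, t, hW, hQW, ht⟩ := exists_glue_germs (fun q ↦ (e q).open_source) hqe s hs
  have hgerm : ∀ x ∈ W, ∃ (q : Q) (O : Set M), x ∈ (e q).source ∧ IsOpen O ∧ x ∈ O ∧
      ∀ y ∈ O, (y ∈ N q ↔ (t y).1) ∧ (y ∈ N q → Y q y = (t y).2) := by
    intro x hx
    obtain ⟨q, hxq, h1⟩ := ht x hx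
    obtain ⟨O, hO, hOo, hxO⟩ := mem_nhds_iff.1 h1
    refine ⟨q, O, hxq, hOo, hxO, fun y hy ↦ ?_⟩
    have h2 : t y = s q y := hO hy
    rw [h2]
    exact ⟨Iff.rfl, fun h3 ↦ by simp [s, h3]⟩
  refine ⟨W, {x | (t x).1}, fun x ↦ (t x).2, hW, hQW, ?_, ?_, ?_⟩
  · intro x hx
    obtain ⟨q, O, hxq, hO, hxO, h⟩ := hgerm x hx
    refine ⟨(e q).restr O, L q, ?_, hL q, (he q).restr hO fun y hy ↦ (h y hy).1⟩
    rw [(e q).restr_source' O hO]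
    exact ⟨hxq, hxO⟩
  · intro x hx
    obtain ⟨q, O, hxq, hO, hxO, h⟩ := hgerm x hx
    exact IsAnalyticAlongAt.congr ⟨e q, L q, hxq, he q, hY q⟩ hO hxO
      (fun y hy ↦ (h y hy).1) fun y hy ↦ (h y hy).2
  · intro x hx
    obtain ⟨q, O, hxq, hO, hxO, h⟩ := hgerm x (hQW hx)
    obtain ⟨h1, h2⟩ := hQN q x hx hxq
    exact ⟨(h x hxO).1.1 h1, ((h x hxO).2 h1).symm.trans h2⟩

end Global

theorem mainTheorem3
    {E : Type*} [NormedAddCommGroup E] [NormedSpace ℂ E] [FiniteDimensional ℂ E]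
    {M : Type*} [TopologicalSpace M] [T2Space M] [SecondCountableTopology M]
    [ChartedSpace E M] [IsManifold 𝓘(ℂ, E) ω M]
    {F : Type*} [NormedAddCommGroup F] [NormedSpace ℂ F] [FiniteDimensional ℂ F]
    {V : M → Type*} [TopologicalSpace (TotalSpace F V)]
    [∀ x, AddCommGroup (V x)] [∀ x, Module ℂ (V x)] [∀ x, TopologicalSpace (V x)]
    [FiberBundle F V] [VectorBundle ℂ F V] [ContMDiffVectorBundle ω F V 𝓘(ℂ, E)]
    (k : ℕ) (Q : Set M) (hQ : IsSubmanifold ℝ (E := E) k Q) (hQr : IsTotallyReal E Q)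
    (X : (x : Q) → V x) (hX : IsAnalyticSection ℝ (E := E) F X) :
    ∃ N : Set M, IsComplexification E k Q N ∧
      (∃! Y : (x : N) → V x, IsAnalyticSection ℂ (E := E) F Y ∧ IsExtensionOf Y X) ∧
      -- local uniqueness near `Q` of the complexification and of the extension
      ∀ Y : (x : N) → V x, IsAnalyticSection ℂ (E := E) F Y → IsExtensionOf Y X →
        ∀ (N' : Set M) (Y' : (x : N') → V x), IsComplexification E k Q N' →
          IsAnalyticSection ℂ (E := E) F Y' → IsExtensionOf Y' X →
          ∃ U : Set M, IsOpen U ∧ Q ⊆ U ∧ N ∩ U = N' ∩ U ∧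
            ∀ (x : M) (hN : x ∈ N) (hN' : x ∈ N'), x ∈ U → Y ⟨x, hN⟩ = Y' ⟨x, hN'⟩ := by
  obtain ⟨W, N₀, Y₀, hW, hQW, hN₀, hY₀, hQN₀⟩ := exists_glued_extension hQ hQr hX
  -- Shrink `N₀` to a union of balls centred at points of `Q`, so that extensions are unique.
  have hball : ∀ q : Q, ∃ (f : OpenPartialHomeomorph M E) (L : Submodule ℂ E) (ρ : ℝ), 0 < ρ ∧
      (q : M) ∈ f.source ∧ f.source ⊆ W ∩ (trivializationAt F V (q : M)).baseSet ∧
      IsSliceChart ℂ N₀ f L ∧ f.target = Metric.ball (f q) ρ := by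
    intro q
    obtain ⟨e, L, hqe, -, he⟩ := hN₀ q (hQW q.2)
    obtain ⟨f, ρ, hρ, hf⟩ := he.exists_target_eq_ball hqe
      (hW.inter (trivializationAt F V (q : M)).open_baseSet)
      ⟨hQW q.2, mem_baseSet_trivializationAt F V (q : M)⟩
    exact ⟨f, L, ρ, hρ, hf⟩
  choose f L ρ hρ hqf hfW hf hft using hball
  let O : Set M := ⋃ q, (f q).source
  have hO : IsOpen O := isOpen_iUnion fun q ↦ (f q).open_source
  have hOW : O ⊆ W := iUnion_subset fun q ↦ (hfW q).trans inter_subset_left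
  have hfO : ∀ q, (f q).source ⊆ O := fun q ↦ subset_iUnion (fun q ↦ (f q).source) q
  let N : Set M := N₀ ∩ O
  have hNO : ∀ x ∈ O, x ∈ N₀ ↔ x ∈ N := fun x hx ↦ ⟨fun h ↦ ⟨h, hx⟩, fun h ↦ h.1⟩
  have hQN : Q ⊆ N := fun x hx ↦ ⟨(hQN₀ x hx).1, hfO ⟨x, hx⟩ (hqf ⟨x, hx⟩)⟩
  have hNsub : IsSubmanifold ℂ (E := E) k N := fun p hp ↦ by
    obtain ⟨e, L, hpe, hL, he⟩ := hN₀ p (hOW hp.2)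
    refine ⟨e.restr O, L, ?_, hL, he.restr hO hNO⟩
    rw [e.restr_source' O hO]
    exact ⟨hpe, hp.2⟩
  have hN : IsComplexification E k Q N := ⟨hNsub, hQ, hQN, hQr, hQr.isGenericIn hQ hNsub hQN⟩
  let Y : (x : N) → V x := fun x ↦ Y₀ x
  have hY : IsAnalyticSection ℂ (E := E) F Y := isAnalyticSection_iff.2 fun p hp ↦
    (hY₀ p (hOW hp.2)).congr hO hp.2 hNO fun x hx hxN ↦
      (extendByZero_of_mem Y ((hNO x hx).1 hxN)).symm
  have hYX : IsExtensionOf Y X := ⟨hQN, fun x hxQ hxN ↦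
    (hQN₀ x hxQ).2.trans (extendByZero_of_mem X hxQ)⟩
  refine ⟨N, hN, ⟨Y, ⟨hY, hYX⟩, fun Z hZ ↦ ?_⟩, fun Z hZ hZX N' Y' hN' hY' hYX' ↦ ?_⟩
  · refine hN.extension_unique hX (fun x hx ↦ ?_) hZ.1 hZ.2 hY hYX
    obtain ⟨q, hxq⟩ := mem_iUnion.1 hx.2
    refine ⟨q, q.2, f q, L q, ρ q, hρ q, ?_, hqf q, hxq, (hfW q).trans inter_subset_right, hft q⟩
    exact isSliceChart_iff.2 ⟨(hf q).1, fun y hy ↦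
      (hNO y (hfO q hy)).symm.trans ((hf q).mem_iff hy)⟩
  · have hev := fun q (hq : q ∈ Q) ↦ hN.eventually_eq hX hN' hZ hZX hY' hYX' hq
    refine ⟨interior {x | (x ∈ N ↔ x ∈ N') ∧ (x ∈ N → extendByZero Z x = extendByZero Y' x)},
      isOpen_interior, fun q hq ↦ mem_interior_iff_mem_nhds.2 (hev q hq), ?_, ?_⟩
    · ext x
      exact and_congr_left fun hx ↦ (interior_subset hx).1
    · intro x hxN hxN' hx
      have := (interior_subset hx).2 hxN
      rwa [extendByZero_of_mem Z hxN, extendByZero_of_mem Y' hxN'] at this
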